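/- **Setting.** Let $(X,\mathsf d)$ be a complete separable metric space, $m\neq 0$ a non-negative Borel measure on $X$ that is finite on balls, and $p\in(1,\infty)$. Let $L^0(m)$ be the space of $m$-a.e. classes of Borel functions $X\to\mathbb R$, and $L^0(m)^+$ the set of $m$-a.e. classes of Borel functions $X\to[0,\infty]$. A function $u\in L^0(m)$ is in $L^p_{loc}(m)$ if $u|_B\in L^p(m|_B)$ for every bounded Borel set $B$; convergence $u_n\to u$ in $L^p_{loc}(m)$ means convergence in $L^p(m|_B)$ for every bounded Borel $B$. $\mathrm{Lip}(f)$ is the (least) Lipschitz constant of a Lipschitz function $f:X\to\mathbb R$. We use the convention $0\cdot\infty=0$. A *$D$-structure* is a map assigning to each $u\in L^p_{loc}(m)$ a set $D[u]\subseteq L^0(m)^+$ of *pseudo-gradients* of $u$ such that: - (A1) $\mathrm{Lip}(u)\,\chi_{\{u>0\}}\in D[u]$ for every Lipschitz $u:X\to[0,\infty)$; - (A2) if $g_1\in D[u_1]$, $g_2\in D[u_2]$, $\alpha_1,\alpha_2\in\mathbb R$, $g\in L^0(m)^+$ and $g\ge|\alpha_1|g_1+|\alpha_2|g_2$ $m$-a.e.,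 then $g\in D[\alpha_1u_1+\alpha_2u_2]$; - (A3) if $g\in D[u]$ and $\varphi:X\to\mathbb R$ is bounded and Lipschitz, then $g\,\sup_X|\varphi|+\mathrm{Lip}(\varphi)|u|\in D[\varphi u]$; - (A4) if $g_1\in D[u_1]$ and $g_2\in D[u_2]$, then $\max\{g_1,g_2\}\in D[\max\{u_1,u_2\}]\cap D[\min\{u_1,u_2\}]$; - (A5) if $g_n\in D[u_n]\cap L^p(m)$ for all $n$, $u_n\to u$ in $L^p_{loc}(m)$ and $g_n\to g$ in $L^p(m)$, with $u\in L^p_{loc}(m)$ and $g\in L^p(m)$ non-negative, then $g\in D[u]$. For $B$ Borel put $\mathcal E_p(u|B):=\inf\{\int_B g^p\,dm: g\in D[u]\}$ and $\mathcal E_p(u):=\mathcal E_p(u|X)$; the *Sobolev class* is the vector space $S^p(X):=\{u\in L^p_{loc}(m):\mathcal E_p(u)<\infty\}$. A *minimal pseudo-gradient* of $u$ is an element $\underline Du\in D[u]$ with $\mathcal E_p(u)=\int_X(\underline Du)^p\,dm$. The $D$-structure is *pointwise local* if - (L1) $\mathcal E_p(u|B)=0$ whenever $u\in S^p(X)$ is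 $m$-a.e. constant on the Borel set $B$, and - (L5) for every $u\in S^p(X)$, $\underline Du\le g$ $m$-a.e. for every $g\in D[u]$. An *$L^p(m)$-normed $L^\infty(m)$-module* is a real Banach space $(\mathscr M,\|\cdot\|)$ that is also a (unital) module over the commutative ring $L^\infty(m)$, with the same addition, and is equipped with a pointwise norm $|\cdot|$ from $\mathscr M$ to the non-negative (a.e. classes of) functions in $L^p(m)$, such that $|f\cdot v|=|f||v|$ $m$-a.e. and $\|v\|=\||v|\|_{L^p(m)}$ for all $f\in L^\infty(m)$, $v\in\mathscr M$. An *isomorphism* of such modules is a bijective $L^\infty(m)$-linear map that preserves the pointwise norm. **Theorem.** Consider a pointwise local $D$-structure on $(X,\mathsf d,m)$. Then every $u\in S^p(X)$ has exactly one minimal pseudo-gradient $\underline Du$, and there exists a couple $(L^p(T^*X;D),d)$, where $L^p(T^*X;D)$ is an $L^p(m)$-normed $L^\infty(m)$-module and $d:S^p(X)\to L^p(T^*X;D)$ is a linear map, such that - (i) $|du|=\underline Du$ $m$-a.e. for every $u\in S^p(X)$; - (ii) the vector space of all elements of the form $\sum_{i=1}^n\chi_{B_i}\,du_i$, where $n\in\mathbb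 N$, $(B_i)_{i=1}^n$ is a Borel partition of $X$ and $u_1,\dots,u_n\in S^p(X)$, is dense in $L^p(T^*X;D)$. This couple is unique up to unique isomorphism: if $(\mathscr M,d')$ is another couple with these properties, there is a unique isomorphism $\Phi:L^p(T^*X;D)\to\mathscr M$ such that $\Phi(du)=d'u$ for all $u\in S^p(X)$. -/

import Mathlib

open MeasureTheory Set Filter Topology
open scoped ENNReal NNReal

universe u v

noncomputable section

/-! ### The commutative ring of bounded functions -/

section Ring

variable {X : Type u} [MeasurableSpace X] {m : Measure X}

/-- `L⁰(m)` is a commutative ring under the almost everywhere pointwise operations. -/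
instance aeEqFunCommRing : CommRing (X →ₘ[m] ℝ) :=
  { (inferInstance : AddCommGroup (X →ₘ[m] ℝ)), (inferInstance : CommMonoid (X →ₘ[m] ℝ)) with
    left_distrib := fun a b c => by
      refine AEEqFun.ext ?_
      filter_upwards [AEEqFun.coeFn_mul a (b + c), AEEqFun.coeFn_add b c,
        AEEqFun.coeFn_add (a * b) (a * c), AEEqFun.coeFn_mul a b, AEEqFun.coeFn_mul a c]
        with x h1 h2 h3 h4 h5
      simp only [h1, h2, h3, h4, h5, Pi.mul_apply, Pi.add_apply, mul_add]
    right_distrib := fun a b c => by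
      refine AEEqFun.ext ?_
      filter_upwards [AEEqFun.coeFn_mul (a + b) c, AEEqFun.coeFn_add a b,
        AEEqFun.coeFn_add (a * c) (b * c), AEEqFun.coeFn_mul a c, AEEqFun.coeFn_mul b c]
        with x h1 h2 h3 h4 h5
      simp only [h1, h2, h3, h4, h5, Pi.mul_apply, Pi.add_apply, add_mul]
    zero_mul := fun a => by
      refine AEEqFun.ext ?_
      filter_upwards [AEEqFun.coeFn_mul 0 a, AEEqFun.coeFn_zero (α := X) (μ := m) (β := ℝ)]
        with x h1 h2
      simp [h1, h2]
    mul_zero := fun a => by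
      refine AEEqFun.ext ?_
      filter_upwards [AEEqFun.coeFn_mul a 0, AEEqFun.coeFn_zero (α := X) (μ := m) (β := ℝ)]
        with x h1 h2
      simp [h1, h2] }

/-- The commutative ring `L^∞(m)` of (classes of) essentially bounded functions. -/
def LInfty (m : Measure X) : Subring (X →ₘ[m] ℝ) where
  carrier := {f | MemLp f ∞ m}
  mul_mem' {f g} hf hg :=
    (MemLp.mul (p := ∞) (q := ∞) (r := ∞) hg hf).ae_eq (AEEqFun.coeFn_mul f g).symm
  one_mem' := (memLp_top_const (1 : ℝ)).ae_eq (AEEqFun.coeFn_one).symm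
  add_mem' {f g} hf hg := (MemLp.add hf hg).ae_eq (AEEqFun.coeFn_add f g).symm
  zero_mem' := (MemLp.zero).ae_eq (AEEqFun.coeFn_zero).symm
  neg_mem' {f} hf := (MemLp.neg hf).ae_eq (AEEqFun.coeFn_neg f).symm

/-- The class of a constant function, as an element of `L^∞(m)`. -/
def LInfty.const (m : Measure X) (c : ℝ) : LInfty m :=
  ⟨AEEqFun.mk (fun _ => c) aestronglyMeasurable_const,
    (memLp_top_const c).ae_eq (AEEqFun.coeFn_mk _ _).symm⟩

/-- The class of the characteristic function of a measurable set, as an element of `L^∞(m)`. -/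
def LInfty.chi (m : Measure X) {B : Set X} (hB : MeasurableSet B) : LInfty m :=
  ⟨AEEqFun.mk (B.indicator fun _ => (1 : ℝ)) (aestronglyMeasurable_const.indicator hB),
    ((memLp_top_const (1 : ℝ)).indicator hB).ae_eq (AEEqFun.coeFn_mk _ _).symm⟩

theorem chi_sum {n : ℕ} {B : Fin n → Set X} (hB : ∀ i, MeasurableSet (B i))
    (hd : Pairwise (fun i j => Disjoint (B i) (B j))) (hU : (⋃ i, B i) = univ) :
    ∑ i, LInfty.chi m (hB i) = 1 := by
  refine Subtype.ext (AEEqFun.ext ?_)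
  have h1 : ∀ s : Finset (Fin n),
      ((∑ i ∈ s, LInfty.chi m (hB i) : LInfty m) : X →ₘ[m] ℝ) =ᵐ[m]
        fun x => ∑ i ∈ s, (B i).indicator (fun _ => (1 : ℝ)) x := by
    intro s
    induction s using Finset.induction_on with
    | empty =>
      filter_upwards [AEEqFun.coeFn_zero (α := X) (μ := m) (β := ℝ)] with x hx
      simp [hx]
    | insert a s ha ih =>
      have hc : (LInfty.chi m (hB a) : X →ₘ[m] ℝ) =ᵐ[m]
        (B a).indicator fun _ => (1 : ℝ) := AEEqFun.coeFn_mk _ _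
      rw [Finset.sum_insert ha]
      filter_upwards [AEEqFun.coeFn_add (LInfty.chi m (hB a) : X →ₘ[m] ℝ)
        ((∑ i ∈ s, LInfty.chi m (hB i) : LInfty m) : X →ₘ[m] ℝ), ih, hc] with x h1 h2 h3
      rw [Finset.sum_insert ha, Subring.coe_add, h1, Pi.add_apply, h2, h3]
  filter_upwards [h1 Finset.univ, AEEqFun.coeFn_one (α := X) (μ := m) (β := ℝ)] with x hx hx1
  rw [hx, Subring.coe_one, hx1]
  obtain ⟨i, hi⟩ := mem_iUnion.1 (hU ▸ mem_univ x)
  rw [Finset.sum_eq_single i]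
  · simp [hi]
  · intro j _ hj
    exact indicator_of_notMem (fun hxj => disjoint_left.1 (hd hj) hxj hi) _
  · simp

end Ring

/-! ### Normed modules -/

/-- An `L^p(m)`-normed `L^∞(m)`-module: a real Banach space which is a module over the ring
`L^∞(m)`, with a pointwise norm. The pointwise norm takes values in classes of functions
`X → [0, ∞]`; it lies in `L^p(m)` because the norms of elements are finite. -/
structure LpNormedModule {X : Type u} [MeasurableSpace X] (p : ℝ≥0∞) (m : Measure X) where
  /-- the underlying set -/
  carrier : Type v
  [normedAddCommGroup : NormedAddCommGroup carrier]
  [normedSpace : NormedSpace ℝ carrier]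
  [completeSpace : CompleteSpace carrier]
  [module : Module (LInfty m) carrier]
  /-- the pointwise norm -/
  ptNorm : carrier → (X →ₘ[m] ℝ≥0∞)
  ptNorm_smul : ∀ (f : LInfty m) (v : carrier),
    ∀ᵐ x ∂m, ptNorm (f • v) x = ‖(f : X →ₘ[m] ℝ) x‖ₑ * ptNorm v x
  enorm_eq : ∀ v : carrier, ‖v‖ₑ = eLpNorm (ptNorm v) p m

namespace LpNormedModule

variable {X : Type u} [MeasurableSpace X] {p : ℝ≥0∞} {m : Measure X}

instance : CoeSort (LpNormedModule.{u, v} p m) (Type v) := ⟨LpNormedModule.carrier⟩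

attribute [instance] normedAddCommGroup normedSpace completeSpace module

/-- Constant functions act as the corresponding real scalars. -/
theorem const_smul_eq (M : LpNormedModule.{u, v} p m) (c : ℝ) (v : M) :
    LInfty.const m c • v = c • v := by
  have hadd : ∀ a b : ℝ, LInfty.const m (a + b) = LInfty.const m a + LInfty.const m b :=
    fun a b => Subtype.ext rfl
  have hone : LInfty.const m 1 = 1 := Subtype.ext rfl
  let F : ℝ →+ M :=
    { toFun := fun a => LInfty.const m a • v
      map_zero' := by
        have h : LInfty.const m 0 = 0 := Subtype.ext rfl
        simp [h]
      map_add' := fun a b => by simp [hadd, add_smul] }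
  have hbound : ∀ a : ℝ, ‖F a‖ ≤ ‖v‖ * ‖a‖ := by
    intro a
    have h1 : ‖F a‖ₑ ≤ ‖a‖ₑ * ‖v‖ₑ := by
      rw [M.enorm_eq, M.enorm_eq]
      have h2 := eLpNorm_le_nnreal_smul_eLpNorm_of_ae_le_mul' (p := p) (μ := m)
        (f := M.ptNorm (F a)) (g := M.ptNorm v) (c := ‖a‖₊) (by
          have hc : (LInfty.const m a : X →ₘ[m] ℝ) =ᵐ[m] fun _ => a := AEEqFun.coeFn_mk _ _
          filter_upwards [M.ptNorm_smul (LInfty.const m a) v, hc] with x hx hx'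
          rw [hx'] at hx
          exact hx.le)
      simpa [ENNReal.smul_def, enorm_eq_nnnorm] using h2
    rw [← ofReal_norm, ← ofReal_norm, ← ofReal_norm, ← ENNReal.ofReal_mul (norm_nonneg _),
      ENNReal.ofReal_le_ofReal_iff (by positivity)] at h1
    linarith
  have hcont : Continuous F := AddMonoidHomClass.continuous_of_bound F ‖v‖ hbound
  have h := map_real_smul F hcont c 1
  simpa [F, hone] using h

end LpNormedModule

/-! ### Axiomatic Sobolev spaces -/

section Sobolev

variable {X : Type u} [MetricSpace X] [MeasurableSpace X]

/-- `L^p_loc(m)`: classes of functions that are in `L^p` of every bounded Borel set. -/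
def LpLoc (p : ℝ≥0∞) (m : Measure X) : Submodule ℝ (X →ₘ[m] ℝ) where
  carrier := {u | ∀ B : Set X, MeasurableSet B → Bornology.IsBounded B → MemLp u p (m.restrict B)}
  add_mem' {u v} hu hv B hB hb :=
    ((hu B hB hb).add (hv B hB hb)).ae_eq (EventuallyEq.symm (ae_restrict_of_ae (AEEqFun.coeFn_add u v)))
  zero_mem' B _ _ := (MemLp.zero).ae_eq (EventuallyEq.symm (ae_restrict_of_ae (AEEqFun.coeFn_zero)))
  smul_mem' c u hu B hB hb :=
    ((hu B hB hb).const_smul c).ae_eq (EventuallyEq.symm (ae_restrict_of_ae (AEEqFun.coeFn_smul c u)))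

/-- The Lipschitz constant `Lip(f)` of a Lipschitz function `f`. -/
def lipConst (f : X → ℝ) : ℝ≥0 := sInf {K : ℝ≥0 | LipschitzWith K f}

/-- A `D`-structure for the exponent `p ∈ [1, ∞)`: a map which associates to each function in
`L^p_loc(m)` a set of pseudo-gradients, these being classes of functions `X → [0, ∞]`. -/
structure DStructure (p : ℝ≥0∞) (m : Measure X) where
  one_le : 1 ≤ p
  lt_top : p < ∞
  /-- the set `D[u]` of the pseudo-gradients of `u` -/
  pg : LpLoc p m → Set (X →ₘ[m] ℝ≥0∞)
  /-- Non triviality: `Lip(u) χ_{u > 0} ∈ D[u]` for `u` Lipschitz and non-negative. -/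
  nontriviality : ∀ f : X → ℝ, (∃ K, LipschitzWith K f) → (∀ x, 0 ≤ f x) →
    ∀ u : LpLoc p m, (∀ᵐ x ∂m, (u : X →ₘ[m] ℝ) x = f x) →
    ∀ g : X →ₘ[m] ℝ≥0∞,
      (∀ᵐ x ∂m, g x = {y | 0 < f y}.indicator (fun _ => (lipConst f : ℝ≥0∞)) x) → g ∈ pg u
  /-- Upper linearity. -/
  upper_linearity : ∀ u₁ u₂ : LpLoc p m, ∀ g₁ ∈ pg u₁, ∀ g₂ ∈ pg u₂, ∀ a₁ a₂ : ℝ,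
    ∀ g : X →ₘ[m] ℝ≥0∞, (∀ᵐ x ∂m, ‖a₁‖ₑ * g₁ x + ‖a₂‖ₑ * g₂ x ≤ g x) →
      g ∈ pg (a₁ • u₁ + a₂ • u₂)
  /-- Leibniz rule: `g sup |φ| + Lip(φ) |u| ∈ D[φ u]` for `φ` Lipschitz and bounded. -/
  leibniz : ∀ u : LpLoc p m, ∀ g ∈ pg u, ∀ φ : X → ℝ, (∃ K, LipschitzWith K φ) →
    (∃ C, ∀ x, |φ x| ≤ C) →
    ∀ w : LpLoc p m, (∀ᵐ x ∂m, (w : X →ₘ[m] ℝ) x = φ x * (u : X →ₘ[m] ℝ) x) →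
    ∀ h : X →ₘ[m] ℝ≥0∞,
      (∀ᵐ x ∂m, h x = g x * (⨆ y, ‖φ y‖ₑ) + lipConst φ * ‖(u : X →ₘ[m] ℝ) x‖ₑ) → h ∈ pg w
  /-- Lattice property, maximum. -/
  lattice_sup : ∀ u₁ u₂ : LpLoc p m, ∀ g₁ ∈ pg u₁, ∀ g₂ ∈ pg u₂, ∀ w : LpLoc p m,
    (w : X →ₘ[m] ℝ) = (u₁ : X →ₘ[m] ℝ) ⊔ (u₂ : X →ₘ[m] ℝ) → g₁ ⊔ g₂ ∈ pg w
  /-- Lattice property, minimum. -/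
  lattice_inf : ∀ u₁ u₂ : LpLoc p m, ∀ g₁ ∈ pg u₁, ∀ g₂ ∈ pg u₂, ∀ w : LpLoc p m,
    (w : X →ₘ[m] ℝ) = (u₁ : X →ₘ[m] ℝ) ⊓ (u₂ : X →ₘ[m] ℝ) → g₁ ⊔ g₂ ∈ pg w
  /-- Completeness: if `gₙ ∈ D[uₙ]`, `uₙ → u` in `L^p_loc(m)` and `gₙ → g` in `L^p(m)`, then
  `g ∈ D[u]`. The functions in `L^p(m)` are finite almost everywhere, so that the differences
  `gₙ - g` make sense as real functions. -/
  completeness : ∀ (u : ℕ → LpLoc p m) (g : ℕ → (X →ₘ[m] ℝ≥0∞)),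
    (∀ n, g n ∈ pg (u n)) → (∀ n, MemLp (g n) p m) →
    ∀ (u' : LpLoc p m) (g' : X →ₘ[m] ℝ≥0∞), MemLp g' p m →
    (∀ B : Set X, MeasurableSet B → Bornology.IsBounded B →
      Tendsto (fun n => eLpNorm
        (fun x => (u n : X →ₘ[m] ℝ) x - (u' : X →ₘ[m] ℝ) x) p (m.restrict B)) atTop (𝓝 0)) →
    Tendsto (fun n => eLpNorm (fun x => (g n x).toReal - (g' x).toReal) p m) atTop (𝓝 0) →
    g' ∈ pg u'

namespace DStructure

variable {p : ℝ≥0∞} {m : Measure X} (D : DStructure p m)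

/-- The `p`-Dirichlet energy of `u` on `B`. -/
def energy (u : LpLoc p m) (B : Set X) : ℝ≥0∞ :=
  ⨅ g ∈ D.pg u, ∫⁻ x in B, g x ^ p.toReal ∂m

theorem energy_lt_top_iff (u : LpLoc p m) :
    D.energy u univ < ∞ ↔ ∃ g ∈ D.pg u, ∫⁻ x, g x ^ p.toReal ∂m < ∞ := by
  simp [energy, iInf_lt_iff]

theorem energy_zero_lt_top : D.energy (0 : LpLoc p m) univ < ∞ := by
  have hp : 0 < p.toReal :=
    ENNReal.toReal_pos (zero_lt_one.trans_le D.one_le).ne' D.lt_top.ne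
  refine (D.energy_lt_top_iff _).2 ⟨0, ?_, ?_⟩
  · refine D.nontriviality (fun _ => 0) ⟨0, LipschitzWith.const 0⟩ (fun _ => le_rfl) 0 ?_ 0 ?_
    · exact AEEqFun.coeFn_zero
    · filter_upwards [AEEqFun.coeFn_zero (α := X) (μ := m) (β := ℝ≥0∞)] with x hx
      simp [hx]
  · rw [lintegral_congr_ae (g := fun _ => 0)]
    · simp
    · filter_upwards [AEEqFun.coeFn_zero (α := X) (μ := m) (β := ℝ≥0∞)] with x hx
      simp [hx, hp]

theorem energy_lt_top_of_linear {u v : LpLoc p m} (hu : D.energy u univ < ∞)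
    (hv : D.energy v univ < ∞) (a b : ℝ) : D.energy (a • u + b • v) univ < ∞ := by
  have hp : 0 ≤ p.toReal := ENNReal.toReal_nonneg
  have hp1 : 1 ≤ p.toReal := by
    simpa using ENNReal.toReal_mono D.lt_top.ne D.one_le
  obtain ⟨g, hg, hgi⟩ := (D.energy_lt_top_iff u).1 hu
  obtain ⟨h, hh, hhi⟩ := (D.energy_lt_top_iff v).1 hv
  have hgm : AEMeasurable (fun x => ‖a‖ₑ * g x) m :=
    g.aestronglyMeasurable.aemeasurable.const_mul _
  have hhm : AEMeasurable (fun x => ‖b‖ₑ * h x) m :=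
    h.aestronglyMeasurable.aemeasurable.const_mul _
  have hs : AEStronglyMeasurable (fun x => ‖a‖ₑ * g x + ‖b‖ₑ * h x) m :=
    (hgm.add hhm).aestronglyMeasurable
  have hmk := AEEqFun.coeFn_mk _ hs
  refine (D.energy_lt_top_iff _).2 ⟨AEEqFun.mk _ hs, ?_, ?_⟩
  · exact D.upper_linearity u v g hg h hh a b _ (by filter_upwards [hmk] with x hx using hx.ge)
  · rw [lintegral_congr_ae (g := fun x => (‖a‖ₑ * g x + ‖b‖ₑ * h x) ^ p.toReal)
      (by filter_upwards [hmk] with x hx; rw [hx])]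
    have key : ∀ (c : ℝ) (k : X →ₘ[m] ℝ≥0∞), ∫⁻ x, k x ^ p.toReal ∂m < ∞ →
        ∫⁻ x, (‖c‖ₑ * k x) ^ p.toReal ∂m < ∞ := by
      intro c k hk
      simp_rw [ENNReal.mul_rpow_of_nonneg _ _ hp]
      rw [lintegral_const_mul'' _ (k.aestronglyMeasurable.aemeasurable.pow_const _)]
      exact ENNReal.mul_lt_top (ENNReal.rpow_lt_top_of_nonneg hp enorm_ne_top) hk
    exact ENNReal.lintegral_rpow_add_lt_top_of_lintegral_rpow_lt_top hgm (key a g hgi)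
      (key b h hhi) hp1

/-- The Sobolev class `S^p(X)`: the functions in `L^p_loc(m)` of finite energy on `X`. -/
def sobolevClass : Submodule ℝ (LpLoc p m) where
  carrier := {u | D.energy u univ < ∞}
  add_mem' {u v} hu hv := by
    simpa using D.energy_lt_top_of_linear hu hv 1 1
  zero_mem' := D.energy_zero_lt_top
  smul_mem' c u hu := by
    simpa using D.energy_lt_top_of_linear hu D.energy_zero_lt_top c 0

/-- `g` is the minimal pseudo-gradient of `u`: it is a pseudo-gradient of `u`, and the energy of
`u` on `X` is the `p`-th power of its `L^p`-norm. -/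
def IsMinimalPG (u : LpLoc p m) (g : X →ₘ[m] ℝ≥0∞) : Prop :=
  g ∈ D.pg u ∧ D.energy u univ = ∫⁻ x, g x ^ p.toReal ∂m

/-- A `D`-structure is pointwise local if the energy of every `u ∈ S^p(X)` vanishes on each Borel
set where `u` is constant, and if the minimal pseudo-gradient of every `u ∈ S^p(X)` is almost
everywhere not larger than any other pseudo-gradient of `u`. -/
structure PointwiseLocal : Prop where
  energy_eq_zero : ∀ u ∈ D.sobolevClass, ∀ B : Set X, MeasurableSet B → ∀ c : ℝ,
    (∀ᵐ x ∂m, x ∈ B → (u : X →ₘ[m] ℝ) x = c) → D.energy u B = 0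
  minimal_le : ∀ u ∈ D.sobolevClass, ∀ g₀, D.IsMinimalPG u g₀ → ∀ g ∈ D.pg u, g₀ ≤ g

/-- The vector space of all finite sums `∑ χ_{B_i} du_i`, where `(B_i)` is a Borel partition
of `X` and the `u_i` are in `S^p(X)`. -/
def simpleForms (M : LpNormedModule.{u, v} p m) (d : D.sobolevClass →ₗ[ℝ] M) :
    Submodule ℝ M where
  carrier := {ω | ∃ (n : ℕ) (B : Fin n → Set X) (hB : ∀ i, MeasurableSet (B i))
    (u : Fin n → D.sobolevClass), Pairwise (fun i j => Disjoint (B i) (B j)) ∧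
      (⋃ i, B i) = univ ∧ ω = ∑ i, LInfty.chi m (hB i) • d (u i)}
  add_mem' := by
    rintro _ _ ⟨n, B, hB, u, hdB, hUB, rfl⟩ ⟨k, C, hC, v, hdC, hUC, rfl⟩
    have hBC : ∀ q : Fin n × Fin k, MeasurableSet (B q.1 ∩ C q.2) :=
      fun q => (hB q.1).inter (hC q.2)
    let e : Fin (n * k) ≃ Fin n × Fin k := finProdFinEquiv.symm
    refine ⟨n * k, fun i => B (e i).1 ∩ C (e i).2, fun i => hBC (e i),
      fun i => u (e i).1 + v (e i).2, ?_, ?_, ?_⟩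
    · intro i j hij
      have hne : e i ≠ e j := fun h => hij (e.injective h)
      by_cases h1 : (e i).1 = (e j).1
      · have h2 : (e i).2 ≠ (e j).2 := fun h2 => hne (Prod.ext h1 h2)
        exact (hdC h2).mono inter_subset_right inter_subset_right
      · exact (hdB h1).mono inter_subset_left inter_subset_left
    · refine eq_univ_of_forall fun x => ?_
      obtain ⟨i, hi⟩ := mem_iUnion.1 (hUB ▸ mem_univ x)
      obtain ⟨j, hj⟩ := mem_iUnion.1 (hUC ▸ mem_univ x)
      exact mem_iUnion.2 ⟨e.symm (i, j), by simpa using ⟨hi, hj⟩⟩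
    · have hchi : ∀ i j, LInfty.chi m (hBC (i, j)) = LInfty.chi m (hB i) * LInfty.chi m (hC j) := by
        intro i j
        refine Subtype.ext ?_
        change AEEqFun.mk _ _ = AEEqFun.mk _ _ * AEEqFun.mk _ _
        rw [AEEqFun.mk_mul_mk]
        congr 1
        funext x
        by_cases h : x ∈ B i <;> by_cases h' : x ∈ C j <;> simp [h, h']
      rw [e.sum_comp (fun q => LInfty.chi m (hBC q) • d (u q.1 + v q.2)),
        Fintype.sum_prod_type]
      simp only [hchi, map_add, smul_add, Finset.sum_add_distrib]
      congr 1
      · refine Finset.sum_congr rfl fun i _ => ?_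
        rw [← Finset.sum_smul, ← Finset.mul_sum, chi_sum hC hdC hUC, mul_one]
      · rw [Finset.sum_comm]
        refine Finset.sum_congr rfl fun j _ => ?_
        rw [← Finset.sum_smul, ← Finset.sum_mul, chi_sum hB hdB hUB, one_mul]
  zero_mem' := by
    refine ⟨1, fun _ => univ, fun _ => MeasurableSet.univ, fun _ => 0, ?_, ?_, ?_⟩
    · intro i j hij
      exact absurd (Subsingleton.elim i j) hij
    · exact iUnion_const univ
    · simp
  smul_mem' := by
    rintro c _ ⟨n, B, hB, u, hdB, hUB, rfl⟩
    refine ⟨n, B, hB, fun i => c • u i, hdB, hUB, ?_⟩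
    rw [Finset.smul_sum]
    refine Finset.sum_congr rfl fun i _ => ?_
    rw [map_smul, ← M.const_smul_eq, ← M.const_smul_eq, smul_smul, smul_smul, mul_comm]

/-- The couple `(M, d)` satisfies the two requirements on the cotangent module and the
differential: `|du|` is the minimal pseudo-gradient of `u` for every `u ∈ S^p(X)`, and the
elements `∑ χ_{B_i} du_i` are dense in `M`. -/
structure IsCotangentModule (M : LpNormedModule.{u, v} p m) (d : D.sobolevClass →ₗ[ℝ] M) :
    Prop where
  ptNorm_d : ∀ u : D.sobolevClass, D.IsMinimalPG u (M.ptNorm (d u))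
  dense : Dense (D.simpleForms M d : Set M)

end DStructure

end Sobolev

end

universe w

noncomputable section

/-! ### Elements of minimal norm in closed convex sets of non-negative functions -/

section MinimalNorm

/-! Minimal pseudo-gradients come from uniform convexity. By (A2) and (A5) the non-negative
functions of `L^p(m)` that are pseudo-gradients of `u` form a closed convex set, and for `1 < p < ∞`
such a set has an element of least norm (`Lp_exists_minimal_norm`). By (L5) two minimal
pseudo-gradients lie below one another, so they coincide. (A2) with (L5) also shows that the minimal
pseudo-gradient is a.e. subadditive and absolutely homogeneous in `u`: a pointwise seminorm on the
Sobolev class `V`.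

Any pointwise seminorm generates a normed module. A formal sum `∑ χ_{B_i} du_i` is the same thing as
a `V`-valued simple function `f`; its pointwise norm at `x` is the seminorm of `f x` evaluated at
`x`, and its norm is the `L^p` norm of that function. The module is the completion for this
seminorm. Real simple functions act by pointwise multiplication with operator norm at most the
essential supremum, so the action extends to `L^∞(m)` (`exists_LInfty_ringHom`); the pointwise norm
is 1-Lipschitz into `L^p(m)`, so it extends as well. The differential sends `u` to the constant
function `u`.

For uniqueness, `ptNorm_stepForm` shows that the norm of a step form depends only on the pointwise
norms of the differentials. Two couples therefore have isometric dense subspaces, the isometry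
extends, and it commutes with characteristic functions. Hence it is `L^∞(m)`-linear and preserves
the pointwise norm, which is determined by the norms of all `χ_B ω` (`existsUnique_equiv`). -/

theorem exists_abs_sub_rpow_le_unitInterval {p : ℝ} (hp : 1 < p) {ε : ℝ} (hε : 0 < ε) :
    ∃ C : ℝ, 0 ≤ C ∧ ∀ t ∈ Icc (0 : ℝ) 1, |2 * t - 1| ^ p ≤
      ε * (t ^ p + (1 - t) ^ p) + C * ((t ^ p + (1 - t) ^ p) / 2 - (1 / 2 : ℝ) ^ p) := by
  have hp0 : 0 < p := by linarith
  set F : ℝ → ℝ := fun t => (t ^ p + (1 - t) ^ p) / 2 - (1 / 2 : ℝ) ^ p with hF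
  set G : ℝ → ℝ := fun t => |2 * t - 1| ^ p - ε * (t ^ p + (1 - t) ^ p) with hG
  have hFc : Continuous F := by
    have h1 : Continuous fun t : ℝ => t ^ p := continuous_id.rpow_const fun _ => Or.inr hp0.le
    have h2 : Continuous fun t : ℝ => (1 - t) ^ p := h1.comp (continuous_const.sub continuous_id)
    fun_prop
  have hGc : Continuous G := by
    have h1 : Continuous fun t : ℝ => t ^ p := continuous_id.rpow_const fun _ => Or.inr hp0.le
    have h2 : Continuous fun t : ℝ => (1 - t) ^ p := h1.comp (continuous_const.sub continuous_id)
    have h3 : Continuous fun t : ℝ => |2 * t - 1| ^ p := h1.comp (by fun_prop)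
    fun_prop
  have hFpos : ∀ t ∈ Icc (0 : ℝ) 1, t ≠ 1 / 2 → 0 < F t := by
    intro t ht hne
    have h1 : 1 - t ∈ Ici (0 : ℝ) := by simpa using ht.2
    have h := (strictConvexOn_rpow hp).2 (mem_Ici.2 ht.1) h1 (fun h => hne (by linarith))
      (one_half_pos (α := ℝ)) (one_half_pos (α := ℝ)) (by norm_num)
    have e : (1 / 2 : ℝ) • t + (1 / 2 : ℝ) • (1 - t) = 1 / 2 := by simp; ring
    rw [e] at h
    simp only [hF, smul_eq_mul] at h ⊢
    linarith
  have hFhalf : F (1 / 2) = 0 := by simp only [hF]; norm_num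
  have hGhalf : G (1 / 2) < 0 := by
    have : (0 : ℝ) < (1 / 2 : ℝ) ^ p := by positivity
    have h0 : |2 * (1 / 2 : ℝ) - 1| ^ p = 0 := by norm_num [hp0.ne']
    simp only [hG, h0]
    norm_num at this ⊢
    positivity
  -- The convexity defect `F` vanishes only at `1 / 2`, where `G < 0`. So `F > 0` on the compact set
  -- where `G ≥ 0`, and `G / F` is bounded there; elsewhere `G < 0 ≤ F`.
  set K : Set ℝ := Icc 0 1 ∩ {t | 0 ≤ G t} with hK
  have hKc : IsCompact K := isCompact_Icc.inter_right (isClosed_le continuous_const hGc)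
  have hFK : ∀ t ∈ K, 0 < F t := fun t ht =>
    hFpos t ht.1 fun h => absurd ht.2 (by simp only [mem_ofPred_eq, h]; exact not_le.2 hGhalf)
  obtain ⟨C, hC⟩ := hKc.exists_bound_of_continuousOn (f := fun t => G t / F t)
    (hGc.continuousOn.div hFc.continuousOn fun t ht => (hFK t ht).ne')
  refine ⟨max C 0, le_max_right _ _, fun t ht => ?_⟩
  have hF0 : 0 ≤ F t := by
    by_cases h : t = 1 / 2
    · rw [h, hFhalf]
    · exact (hFpos t ht h).le
  suffices h : G t ≤ max C 0 * F t by simp only [hG, hF] at h; linarith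
  by_cases h : 0 ≤ G t
  · have h1 := (le_abs_self _).trans (hC t ⟨ht, h⟩)
    have h2 := (div_le_iff₀ (hFK t ⟨ht, h⟩)).1 h1
    exact h2.trans (mul_le_mul_of_nonneg_right (le_max_left _ _) hF0)
  · exact (not_le.1 h).le.trans (mul_nonneg (le_max_right _ _) hF0)

/-- A form of the uniform convexity of `t ↦ t ^ p`. -/
theorem exists_abs_sub_rpow_le {p : ℝ} (hp : 1 < p) {ε : ℝ} (hε : 0 < ε) :
    ∃ C : ℝ, 0 ≤ C ∧ ∀ a b : ℝ, 0 ≤ a → 0 ≤ b → |a - b| ^ p ≤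
      ε * (a ^ p + b ^ p) + C * ((a ^ p + b ^ p) / 2 - ((a + b) / 2) ^ p) := by
  have hp0 : 0 < p := by linarith
  obtain ⟨C, hC0, hC⟩ := exists_abs_sub_rpow_le_unitInterval hp hε
  refine ⟨C, hC0, fun a b ha hb => ?_⟩
  rcases (add_nonneg ha hb).eq_or_lt with h | h
  · obtain rfl : a = 0 := by linarith
    obtain rfl : b = 0 := by linarith
    simp [Real.zero_rpow hp0.ne']
  -- Both sides are homogeneous of degree `p`, so dividing by `a + b` reduces to the pair `t`, `1 -
  -- t`.
  · set S := a + b with hS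
    have ha' : a = S * (a / S) := by field_simp
    have hb' : b = S * (1 - a / S) := by field_simp; linarith
    have ht1 : a / S ≤ 1 := (div_le_one h).2 (by linarith)
    have ht0 : 0 ≤ a / S := by positivity
    generalize a / S = t at *
    have h1 := mul_le_mul_of_nonneg_left (hC t ⟨ht0, ht1⟩) (Real.rpow_nonneg h.le p)
    have e1 : |a - b| ^ p = S ^ p * |2 * t - 1| ^ p := by
      have e : a - b = S * (2 * t - 1) := by rw [ha', hb']; ring
      rw [← Real.mul_rpow h.le (abs_nonneg _), e, abs_mul, abs_of_pos h]
    have e2 : a ^ p = S ^ p * t ^ p := by rw [← Real.mul_rpow h.le ht0, ← ha']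
    have e3 : b ^ p = S ^ p * (1 - t) ^ p := by
      rw [← Real.mul_rpow h.le (by linarith), ← hb']
    have e4 : (S / 2) ^ p = S ^ p * (1 / 2 : ℝ) ^ p := by
      rw [← Real.mul_rpow h.le (by norm_num)]; congr 1; ring
    rw [e1, e2, e3, e4]
    linarith

variable {X : Type u} [MeasurableSpace X] {m : Measure X} {p : ℝ≥0∞}

theorem Lp_norm_rpow_eq_integral (hp0 : p ≠ 0) (hp : p ≠ ∞) (f : Lp ℝ p m) :
    ‖f‖ ^ p.toReal = ∫ x, |f x| ^ p.toReal ∂m := by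
  have hpos : 0 < p.toReal := ENNReal.toReal_pos hp0 hp
  have hI : 0 ≤ ∫ x, ‖f x‖ ^ p.toReal ∂m := integral_nonneg fun x => by positivity
  rw [Lp.norm_def, (Lp.memLp f).eLpNorm_eq_integral_rpow_norm hp0 hp,
    ENNReal.toReal_ofReal (by positivity), ← Real.rpow_mul hI, inv_mul_cancel₀ hpos.ne',
    Real.rpow_one]
  rfl

/-- Integrating the scalar inequality gives the uniform convexity of `L^p` on the cone of
non-negative functions: a small midpoint defect forces the two functions to be close, up to the `ε`
term. -/
theorem Lp_exists_norm_sub_rpow_le (hp1 : 1 < p) (hp : p ≠ ∞) {ε : ℝ} (hε : 0 < ε) :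
    ∃ C : ℝ, 0 ≤ C ∧ ∀ f g : Lp ℝ p m, 0 ≤ f → 0 ≤ g → ‖f - g‖ ^ p.toReal ≤
      ε * (‖f‖ ^ p.toReal + ‖g‖ ^ p.toReal) + C * ((‖f‖ ^ p.toReal + ‖g‖ ^ p.toReal) / 2 -
        ‖(1 / 2 : ℝ) • f + (1 / 2 : ℝ) • g‖ ^ p.toReal) := by
  have hp0 : p ≠ 0 := (zero_lt_one.trans hp1).ne'
  have hq : 1 < p.toReal := by
    simpa using (ENNReal.toReal_lt_toReal ENNReal.one_ne_top hp).2 hp1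
  obtain ⟨C, hC0, hC⟩ := exists_abs_sub_rpow_le hq hε
  refine ⟨C, hC0, fun f g hf hg => ?_⟩
  have hint : ∀ h : Lp ℝ p m, Integrable (fun x => |h x| ^ p.toReal) m := fun h =>
    (Lp.memLp h).integrable_norm_rpow hp0 hp
  simp only [Lp_norm_rpow_eq_integral hp0 hp]
  set k : Lp ℝ p m := (1 / 2 : ℝ) • f + (1 / 2 : ℝ) • g with hk
  have h1 : Integrable (fun x => |f x| ^ p.toReal + |g x| ^ p.toReal) m :=
    (hint f).add (hint g)
  have h2 : Integrable (fun x => (|f x| ^ p.toReal + |g x| ^ p.toReal) / 2 -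
    |k x| ^ p.toReal) m := (h1.div_const 2).sub (hint k)
  rw [← integral_add (hint f) (hint g), ← integral_const_mul, ← integral_div,
    ← integral_sub (h1.div_const 2) (hint k), ← integral_const_mul,
    ← integral_add (h1.const_mul ε) (h2.const_mul C)]
  refine integral_mono_ae (hint _) ((h1.const_mul ε).add (h2.const_mul C)) ?_
  filter_upwards [Lp.coeFn_sub f g, Lp.coeFn_add ((1 / 2 : ℝ) • f) ((1 / 2 : ℝ) • g),
    Lp.coeFn_smul (1 / 2 : ℝ) f, Lp.coeFn_smul (1 / 2 : ℝ) g, (Lp.coeFn_nonneg f).2 hf,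
    (Lp.coeFn_nonneg g).2 hg] with x h1 h2 h3 h4 h5 h6
  simp only [Pi.zero_apply] at h5 h6
  have e : |k x| = (f x + g x) / 2 := by
    rw [hk, h2, Pi.add_apply, h3, h4, Pi.smul_apply, Pi.smul_apply, smul_eq_mul, smul_eq_mul,
      abs_of_nonneg (by positivity)]
    ring
  have h := hC (f x) (g x) h5 h6
  simp only [e, h1, Pi.sub_apply, abs_of_nonneg h5, abs_of_nonneg h6]
  exact h

/-- A nonempty closed convex set of non-negative functions of `L^p`, `1 < p < ∞`, has an element
of minimal norm. -/
theorem Lp_exists_minimal_norm [Fact (1 ≤ p)] (hp1 : 1 < p) (hp : p ≠ ∞) {K : Set (Lp ℝ p m)}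
    (hne : K.Nonempty) (hconv : Convex ℝ K) (hcl : IsClosed K) (hnn : ∀ f ∈ K, 0 ≤ f) :
    ∃ f ∈ K, ∀ g ∈ K, ‖f‖ ≤ ‖g‖ := by
  have hq : 0 < p.toReal := ENNReal.toReal_pos (zero_lt_one.trans hp1).ne' hp
  set S : Set ℝ := (fun f : Lp ℝ p m => ‖f‖ ^ p.toReal) '' K with hS
  have hSne : S.Nonempty := hne.image _
  have hSb : BddBelow S := ⟨0, by rintro _ ⟨f, -, rfl⟩; positivity⟩
  set I := sInf S with hI
  have hIle : ∀ f ∈ K, I ≤ ‖f‖ ^ p.toReal := fun f hf => csInf_le hSb ⟨f, hf, rfl⟩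
  have hex : ∀ n : ℕ, ∃ f ∈ K, ‖f‖ ^ p.toReal < I + 1 / ((n : ℝ) + 1) := by
    intro n
    obtain ⟨_, ⟨f, hf, rfl⟩, h⟩ := exists_lt_of_csInf_lt hSne
      (lt_add_of_pos_right I (Nat.one_div_pos_of_nat (α := ℝ) (n := n)))
    exact ⟨f, hf, h⟩
  choose f hfK hf using hex
  have hI0 : 0 ≤ I := le_csInf hSne (by rintro _ ⟨f, -, rfl⟩; positivity)
  have hcauchy : CauchySeq f := by
    rw [Metric.cauchySeq_iff]
    intro δ hδ
    have hδp : 0 < δ ^ p.toReal := by positivity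
    -- For large indices both `p`-th powers are at most `I + 1`, so this `ε` makes the first term at
    -- most `δ ^ p / 2`. The midpoint lies in `K`, so its power is at least `I`, and the second term
    -- is at most `δ ^ p / 4`. The added ones avoid division by zero.
    obtain ⟨C, hC0, hC⟩ := Lp_exists_norm_sub_rpow_le (m := m) hp1 hp
      (ε := δ ^ p.toReal / (4 * (I + 1))) (by positivity)
    obtain ⟨n₀, hn₀⟩ := exists_nat_one_div_lt (K := ℝ)
      (ε := min 1 (δ ^ p.toReal / (4 * (C + 1)))) (by positivity)
    have hlt : ∀ n ≥ n₀, ‖f n‖ ^ p.toReal < I + min 1 (δ ^ p.toReal / (4 * (C + 1))) := by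
      intro n hn
      have h1 : 1 / ((n : ℝ) + 1) ≤ 1 / ((n₀ : ℝ) + 1) := Nat.one_div_le_one_div hn
      linarith [hf n]
    refine ⟨n₀, fun i hi j hj => ?_⟩
    rw [dist_eq_norm]
    have h := hC (f i) (f j) (hnn _ (hfK i)) (hnn _ (hfK j))
    have hmid := hIle _ (hconv (hfK i) (hfK j) (a := 1 / 2) (b := 1 / 2)
      (by norm_num) (by norm_num) (by norm_num))
    have hi1 := hlt i hi
    have hj1 := hlt j hj
    have hm1 := min_le_left 1 (δ ^ p.toReal / (4 * (C + 1)))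
    have hm2 := min_le_right 1 (δ ^ p.toReal / (4 * (C + 1)))
    have b1 : δ ^ p.toReal / (4 * (I + 1)) * (‖f i‖ ^ p.toReal + ‖f j‖ ^ p.toReal) ≤
        δ ^ p.toReal / (4 * (I + 1)) * (2 * (I + 1)) :=
      mul_le_mul_of_nonneg_left (by linarith) (by positivity)
    have b2 : C * ((‖f i‖ ^ p.toReal + ‖f j‖ ^ p.toReal) / 2 -
        ‖(1 / 2 : ℝ) • f i + (1 / 2 : ℝ) • f j‖ ^ p.toReal) ≤
        C * (δ ^ p.toReal / (4 * (C + 1))) := mul_le_mul_of_nonneg_left (by linarith) hC0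
    have e1 : δ ^ p.toReal / (4 * (I + 1)) * (2 * (I + 1)) = δ ^ p.toReal / 2 := by
      field_simp; ring
    have e2 : C * (δ ^ p.toReal / (4 * (C + 1))) ≤ δ ^ p.toReal / 4 := by
      rw [← mul_div_assoc, div_le_div_iff₀ (by positivity) (by positivity)]
      nlinarith
    refine lt_of_not_ge fun hge => ?_
    have := Real.rpow_le_rpow hδ.le hge hq.le
    linarith
  obtain ⟨g, hg⟩ := cauchySeq_tendsto_of_complete hcauchy
  refine ⟨g, hcl.mem_of_tendsto hg (Eventually.of_forall hfK), fun k hk => ?_⟩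
  have h1 : Tendsto (fun n => ‖f n‖ ^ p.toReal) atTop (𝓝 (‖g‖ ^ p.toReal)) :=
    (hg.norm).rpow_const (Or.inr hq.le)
  have h2 : Tendsto (fun n : ℕ => I + 1 / ((n : ℝ) + 1)) atTop (𝓝 (I + 0)) :=
    tendsto_const_nhds.add tendsto_one_div_add_atTop_nhds_zero_nat
  have h3 := le_of_tendsto_of_tendsto' h1 h2 fun n => (hf n).le
  rw [add_zero] at h3
  exact (Real.rpow_le_rpow_iff (norm_nonneg _) (norm_nonneg _) hq).1 (h3.trans (hIle k hk))

end MinimalNorm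

/-! ### Real functions as extended non-negative functions -/

section OfReal

variable {X : Type u} [MeasurableSpace X] {m : Measure X} {p : ℝ≥0∞}

/-- The class of `ENNReal.ofReal ∘ f`. -/
def ofRealClass (f : X →ₘ[m] ℝ) : X →ₘ[m] ℝ≥0∞ :=
  AEEqFun.comp ENNReal.ofReal ENNReal.continuous_ofReal f

theorem coeFn_ofRealClass (f : X →ₘ[m] ℝ) :
    ofRealClass f =ᵐ[m] fun x => ENNReal.ofReal (f x) :=
  AEEqFun.coeFn_comp _ _ _

theorem eLpNorm_ofRealClass {f : X →ₘ[m] ℝ} (hf : 0 ≤ᵐ[m] f) :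
    eLpNorm (ofRealClass f) p m = eLpNorm f p m := by
  refine eLpNorm_congr_enorm_ae ?_
  filter_upwards [coeFn_ofRealClass f, hf] with x h1 h2
  rw [h1, enorm_eq_self, ← Real.enorm_of_nonneg h2]

theorem memLp_iff_lintegral_rpow_lt_top (hp0 : p ≠ 0) (hp : p ≠ ∞) (g : X →ₘ[m] ℝ≥0∞) :
    MemLp g p m ↔ ∫⁻ x, g x ^ p.toReal ∂m < ∞ := by
  rw [MemLp, eLpNorm_lt_top_iff_lintegral_rpow_enorm_lt_top hp0 hp]
  simp [g.aestronglyMeasurable]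

theorem ae_ne_top_of_memLp (hp0 : p ≠ 0) (hp : p ≠ ∞) {g : X →ₘ[m] ℝ≥0∞} (hg : MemLp g p m) :
    ∀ᵐ x ∂m, g x ≠ ∞ := by
  have h := (memLp_iff_lintegral_rpow_lt_top hp0 hp g).1 hg
  filter_upwards [ae_lt_top' (g.aestronglyMeasurable.aemeasurable.pow_const _) h.ne] with x hx
  exact ((ENNReal.rpow_lt_top_iff_of_pos (ENNReal.toReal_pos hp0 hp)).1 hx).ne

theorem memLp_toReal (hp0 : p ≠ 0) (hp : p ≠ ∞) {g : X →ₘ[m] ℝ≥0∞} (hg : MemLp g p m) :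
    MemLp (fun x => (g x).toReal) p m := by
  refine ⟨g.aestronglyMeasurable.aemeasurable.ennreal_toReal.aestronglyMeasurable,
    (eLpNorm_congr_enorm_ae ?_).trans_lt hg.2⟩
  filter_upwards [ae_ne_top_of_memLp hp0 hp hg] with x hx
  rw [enorm_eq_self, Real.enorm_of_nonneg ENNReal.toReal_nonneg, ENNReal.ofReal_toReal hx]

/-- Lets the minimisation run in the Banach space `Lp ℝ p m`: an extended function with finite `L^p`
norm is finite a.e. -/
theorem exists_Lp_ofRealClass_eq {g : X →ₘ[m] ℝ≥0∞} (hp0 : p ≠ 0) (hp : p ≠ ∞)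
    (hg : MemLp g p m) :
    ∃ h : Lp ℝ p m, 0 ≤ h ∧ ofRealClass (h : X →ₘ[m] ℝ) = g := by
  have hL := memLp_toReal hp0 hp hg
  refine ⟨hL.toLp, ?_, AEEqFun.ext ?_⟩
  · rw [← Lp.coeFn_nonneg]
    filter_upwards [hL.coeFn_toLp] with x hx
    rw [hx]
    exact ENNReal.toReal_nonneg
  · filter_upwards [coeFn_ofRealClass (hL.toLp : X →ₘ[m] ℝ), hL.coeFn_toLp,
      ae_ne_top_of_memLp hp0 hp hg]
      with x h1 h2 h3
    rw [h1, h2, ENNReal.ofReal_toReal h3]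

theorem lintegral_rpow_eq_eLpNorm (hp0 : p ≠ 0) (hp : p ≠ ∞) (g : X →ₘ[m] ℝ≥0∞) :
    ∫⁻ x, g x ^ p.toReal ∂m = eLpNorm g p m ^ p.toReal := by
  rw [eLpNorm_eq_lintegral_rpow_enorm_toReal hp0 hp, ← ENNReal.rpow_mul,
    one_div_mul_cancel (ENNReal.toReal_pos hp0 hp).ne', ENNReal.rpow_one]
  simp

end OfReal

/-! ### Minimal pseudo-gradients -/

namespace DStructure

variable {X : Type u} [MetricSpace X] [MeasurableSpace X] {p : ℝ≥0∞} {m : Measure X}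
  (D : DStructure p m)

theorem ne_zero (D : DStructure p m) : p ≠ 0 := (zero_lt_one.trans_le D.one_le).ne'

variable {D}

/-- The set of the functions in `L^p(m)` that are pseudo-gradients of `u`. -/
def lpPseudoGradients (D : DStructure p m) (u : LpLoc p m) : Set (Lp ℝ p m) :=
  {h | 0 ≤ h ∧ ofRealClass (h : X →ₘ[m] ℝ) ∈ D.pg u}

/-- This is (A2) applied to `u = a • u + b • u`. -/
theorem convex_lpPseudoGradients (u : LpLoc p m) : Convex ℝ (D.lpPseudoGradients u) := by
  intro f hf g hg a b ha hb hab
  have key := D.upper_linearity u u _ hf.2 _ hg.2 a b (ofRealClass ((a • f + b • g : Lp ℝ p m)))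
    (by
      filter_upwards [coeFn_ofRealClass (f : X →ₘ[m] ℝ), coeFn_ofRealClass (g : X →ₘ[m] ℝ),
        coeFn_ofRealClass ((a • f + b • g : Lp ℝ p m) : X →ₘ[m] ℝ),
        Lp.coeFn_add (a • f) (b • g), Lp.coeFn_smul a f, Lp.coeFn_smul b g,
        (Lp.coeFn_nonneg f).2 hf.1, (Lp.coeFn_nonneg g).2 hg.1] with x h1 h2 h3 h4 h5 h6 h7 h8
      simp only [Pi.zero_apply] at h7 h8
      rw [h1, h2, h3, h4, Pi.add_apply, h5, h6, Pi.smul_apply, Pi.smul_apply, smul_eq_mul,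
        smul_eq_mul, Real.enorm_of_nonneg ha, Real.enorm_of_nonneg hb, ← ENNReal.ofReal_mul ha,
        ← ENNReal.ofReal_mul hb, ← ENNReal.ofReal_add (by positivity) (by positivity)])
  rw [← add_smul, hab, one_smul] at key
  refine ⟨?_, key⟩
  rw [← Lp.coeFn_nonneg]
  filter_upwards [Lp.coeFn_add (a • f) (b • g), Lp.coeFn_smul a f, Lp.coeFn_smul b g,
        (Lp.coeFn_nonneg f).2 hf.1, (Lp.coeFn_nonneg g).2 hg.1] with x h4 h5 h6 h7 h8
  simp only [Pi.zero_apply] at h7 h8 ⊢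
  rw [h4, Pi.add_apply, h5, h6, Pi.smul_apply, Pi.smul_apply, smul_eq_mul, smul_eq_mul]
  positivity

/-- This is (A5) for the constant sequence `uₙ = u`. -/
theorem isClosed_lpPseudoGradients (u : LpLoc p m) :
    have : Fact (1 ≤ p) := ⟨D.one_le⟩
    IsClosed (D.lpPseudoGradients u) := by
  have : Fact (1 ≤ p) := ⟨D.one_le⟩
  rw [← isSeqClosed_iff_isClosed]
  intro f g hf hg
  have hg0 : 0 ≤ g := (isClosed_Ici (a := (0 : Lp ℝ p m))).mem_of_tendsto hg
    (Eventually.of_forall fun n => (hf n).1)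
  have hmem : ∀ h : Lp ℝ p m, 0 ≤ h → MemLp (ofRealClass (h : X →ₘ[m] ℝ)) p m := fun h hh =>
    ⟨AEEqFun.aestronglyMeasurable _,
      (eLpNorm_ofRealClass ((Lp.coeFn_nonneg h).2 hh)).trans_lt (Lp.memLp h).2⟩
  refine ⟨hg0, D.completeness (fun _ => u) (fun n => ofRealClass (f n : X →ₘ[m] ℝ))
    (fun n => (hf n).2) (fun n => hmem _ (hf n).1) u _ (hmem g hg0) (fun B _ _ => by simp) ?_⟩
  refine ((Lp.tendsto_Lp_iff_tendsto_eLpNorm' f g).1 hg).congr fun n => eLpNorm_congr_ae ?_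
  filter_upwards [coeFn_ofRealClass (f n : X →ₘ[m] ℝ), coeFn_ofRealClass (g : X →ₘ[m] ℝ),
    (Lp.coeFn_nonneg (f n)).2 (hf n).1, (Lp.coeFn_nonneg g).2 hg0] with x h1 h2 h3 h4
  rw [h1, h2, ENNReal.toReal_ofReal h3, ENNReal.toReal_ofReal h4, Pi.sub_apply]

theorem exists_isMinimalPG (hp : 1 < p) {u : LpLoc p m} (hu : u ∈ D.sobolevClass) :
    ∃ g, D.IsMinimalPG u g := by
  have : Fact (1 ≤ p) := ⟨D.one_le⟩
  have hp0 := D.ne_zero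
  have hpt := D.lt_top.ne
  obtain ⟨g, hg, hgi⟩ := (D.energy_lt_top_iff u).1 hu
  have hex : ∀ g ∈ D.pg u, ∫⁻ x, g x ^ p.toReal ∂m < ∞ →
      ∃ h ∈ D.lpPseudoGradients u, ofRealClass (h : X →ₘ[m] ℝ) = g := fun g hg hgi => by
    obtain ⟨h, h0, rfl⟩ :=
      exists_Lp_ofRealClass_eq hp0 hpt ((memLp_iff_lintegral_rpow_lt_top hp0 hpt g).2 hgi)
    exact ⟨h, ⟨h0, hg⟩, rfl⟩
  have hint : ∀ h ∈ D.lpPseudoGradients u,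
      ∫⁻ x, ofRealClass (h : X →ₘ[m] ℝ) x ^ p.toReal ∂m = ‖h‖ₑ ^ p.toReal := fun h hh => by
    rw [lintegral_rpow_eq_eLpNorm hp0 hpt, eLpNorm_ofRealClass ((Lp.coeFn_nonneg h).2 hh.1),
      Lp.enorm_def]
  obtain ⟨h, hh, -⟩ := hex g hg hgi
  obtain ⟨f, hf, hmin⟩ := Lp_exists_minimal_norm hp hpt ⟨h, hh⟩
    (convex_lpPseudoGradients u) (isClosed_lpPseudoGradients u) fun k hk => hk.1
  refine ⟨ofRealClass (f : X →ₘ[m] ℝ), hf.2, le_antisymm ?_ ?_⟩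
  · simpa [energy] using iInf₂_le (f := fun g (_ : g ∈ D.pg u) => ∫⁻ x, g x ^ p.toReal ∂m) _ hf.2
  · simp only [energy, Measure.restrict_univ]
    refine le_iInf₂ fun k hk => ?_
    -- A competitor of finite energy is represented in `L^p(m)`, where `f` has least norm; one of
    -- infinite energy needs no comparison.
    by_cases hki : ∫⁻ x, k x ^ p.toReal ∂m < ∞
    · obtain ⟨k, hk', rfl⟩ := hex k hk hki
      rw [hint f hf, hint k hk']
      gcongr
      exact enorm_le_iff_norm_le.2 (hmin k hk')
    · rw [not_lt_top_iff.1 hki]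
      exact le_top

theorem PointwiseLocal.existsUnique_isMinimalPG (hD : D.PointwiseLocal) (hp : 1 < p)
    {u : LpLoc p m} (hu : u ∈ D.sobolevClass) : ∃! g, D.IsMinimalPG u g := by
  obtain ⟨g, hg⟩ := exists_isMinimalPG hp hu
  exact ⟨g, hg, fun h hh => le_antisymm (hD.minimal_le u hu h hh g hg.1)
    (hD.minimal_le u hu g hg h hh.1)⟩

theorem IsMinimalPG.memLp {u : LpLoc p m} (hu : u ∈ D.sobolevClass) {g : X →ₘ[m] ℝ≥0∞}
    (hg : D.IsMinimalPG u g) : MemLp g p m :=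
  (memLp_iff_lintegral_rpow_lt_top D.ne_zero D.lt_top.ne g).2 (hg.2 ▸ hu)

/-- By (A2) the right-hand side is a pseudo-gradient of the combination, and (L5) puts the minimal
one below it. -/
theorem PointwiseLocal.ae_le_of_isMinimalPG (hD : D.PointwiseLocal) {u₁ u₂ : LpLoc p m}
    (hu₁ : u₁ ∈ D.sobolevClass) (hu₂ : u₂ ∈ D.sobolevClass) (a b : ℝ)
    {g₁ g₂ g : X →ₘ[m] ℝ≥0∞} (hg₁ : D.IsMinimalPG u₁ g₁) (hg₂ : D.IsMinimalPG u₂ g₂)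
    (hg : D.IsMinimalPG (a • u₁ + b • u₂) g) :
    ∀ᵐ x ∂m, g x ≤ ‖a‖ₑ * g₁ x + ‖b‖ₑ * g₂ x := by
  have hs : AEStronglyMeasurable (fun x => ‖a‖ₑ * g₁ x + ‖b‖ₑ * g₂ x) m :=
    ((g₁.aestronglyMeasurable.aemeasurable.const_mul _).add
      (g₂.aestronglyMeasurable.aemeasurable.const_mul _)).aestronglyMeasurable
  have hmk := AEEqFun.coeFn_mk _ hs
  have h := hD.minimal_le _ (add_mem (D.sobolevClass.smul_mem a hu₁)
    (D.sobolevClass.smul_mem b hu₂)) g hg _ (D.upper_linearity u₁ u₂ g₁ hg₁.1 g₂ hg₂.1 a b _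
      (by filter_upwards [hmk] with x hx using hx.ge))
  filter_upwards [AEEqFun.coeFn_le.2 h, hmk] with x h1 h2
  exact h1.trans_eq h2

end DStructure

/-! ### Simple functions as bounded functions -/

section SimpleClass

variable {X : Type u} [MeasurableSpace X] {m : Measure X}

/-- The class of a real simple function, as an element of `L^∞(m)`. -/
def simpleClass (m : Measure X) : SimpleFunc X ℝ →+* LInfty m where
  toFun s := ⟨AEEqFun.mk s s.aestronglyMeasurable,
    (s.memLp_top m).ae_eq (AEEqFun.coeFn_mk _ _).symm⟩
  map_one' := rfl
  map_mul' _ _ := rfl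
  map_zero' := rfl
  map_add' _ _ := rfl

theorem coeFn_simpleClass (s : SimpleFunc X ℝ) :
    ((simpleClass m s : LInfty m) : X →ₘ[m] ℝ) =ᵐ[m] s :=
  AEEqFun.coeFn_mk _ _

theorem coeFn_chi {B : Set X} (hB : MeasurableSet B) :
    (LInfty.chi m hB : X →ₘ[m] ℝ) =ᵐ[m] B.indicator fun _ => (1 : ℝ) :=
  AEEqFun.coeFn_mk _ _

theorem coeFn_LInfty_sub (f g : LInfty m) :
    ((f - g : LInfty m) : X →ₘ[m] ℝ) =ᵐ[m] fun x =>
      (f : X →ₘ[m] ℝ) x - (g : X →ₘ[m] ℝ) x :=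
  AEEqFun.coeFn_sub (f : X →ₘ[m] ℝ) g

/-- The characteristic function of a measurable set, as a simple function. -/
def simpleChi {B : Set X} (hB : MeasurableSet B) : SimpleFunc X ℝ :=
  SimpleFunc.piecewise B hB (SimpleFunc.const X 1) (SimpleFunc.const X 0)

theorem simpleChi_apply {B : Set X} (hB : MeasurableSet B) (x : X) :
    simpleChi hB x = B.indicator (fun _ => (1 : ℝ)) x := by
  classical
  simp [simpleChi, SimpleFunc.coe_piecewise, Set.piecewise, Set.indicator]

theorem simpleClass_simpleChi {B : Set X} (hB : MeasurableSet B) :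
    simpleClass m (simpleChi hB) = LInfty.chi m hB := by
  refine Subtype.ext (AEEqFun.ext ?_)
  filter_upwards [coeFn_simpleClass (m := m) (simpleChi hB), coeFn_chi (m := m) hB] with x h1 h2
  rw [h1, h2, simpleChi_apply]

theorem simpleClass_const (c : ℝ) :
    simpleClass m (SimpleFunc.const X c) = LInfty.const m c := rfl

theorem chi_mul_chi {A B : Set X} (hA : MeasurableSet A) (hB : MeasurableSet B) :
    LInfty.chi m hA * LInfty.chi m hB = LInfty.chi m (hA.inter hB) := by
  simp only [← simpleClass_simpleChi, ← map_mul]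
  congr 1
  ext x
  by_cases h1 : x ∈ A <;> by_cases h2 : x ∈ B <;> simp [simpleChi_apply, h1, h2]

theorem chi_mul_chi_of_subset {A B : Set X} (hA : MeasurableSet A) (hB : MeasurableSet B)
    (h : A ⊆ B) : LInfty.chi m hA * LInfty.chi m hB = LInfty.chi m hA := by
  rw [chi_mul_chi]
  congr 1
  exact inter_eq_left.2 h

theorem chi_mul_chi_of_disjoint {A B : Set X} (hA : MeasurableSet A) (hB : MeasurableSet B)
    (h : Disjoint A B) : LInfty.chi m hA * LInfty.chi m hB = 0 := by
  simp only [← simpleClass_simpleChi, ← map_mul]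
  rw [← map_zero (simpleClass m)]
  congr 1
  ext x
  by_cases h1 : x ∈ A
  · simp [simpleChi_apply, h1, disjoint_left.1 h h1]
  · simp [simpleChi_apply, h1]

theorem simpleFunc_sum_apply {ι : Type*} (t : Finset ι) (f : ι → SimpleFunc X ℝ) (x : X) :
    (∑ i ∈ t, f i) x = ∑ i ∈ t, f i x := by
  classical
  induction t using Finset.induction_on with
  | empty => simp
  | insert a t ha ih => simp [Finset.sum_insert ha, ih]

theorem sum_chi_fiber {γ : Type*} (r : SimpleFunc X γ) :
    ∑ c ∈ r.range, LInfty.chi m (r.measurableSet_fiber c) = 1 := by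
  simp only [← simpleClass_simpleChi, ← map_sum]
  rw [← map_one (simpleClass m)]
  congr 1
  ext x
  rw [simpleFunc_sum_apply, Finset.sum_eq_single (r x)]
  · simp [simpleChi_apply]
  · intro b _ hb
    simp [simpleChi_apply, hb.symm]
  · intro h
    exact absurd (r.mem_range_self x) h

theorem simpleClass_eq_sum (s : SimpleFunc X ℝ) :
    simpleClass m s = ∑ c ∈ s.range, LInfty.const m c * LInfty.chi m (s.measurableSet_fiber c) := by
  simp only [← simpleClass_simpleChi, ← simpleClass_const, ← map_mul, ← map_sum]
  congr 1
  ext x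
  rw [simpleFunc_sum_apply, Finset.sum_eq_single (s x)]
  · simp [simpleChi_apply]
  · intro b _ hb
    simp [simpleChi_apply, hb.symm]
  · intro h
    exact absurd (s.mem_range_self x) h

/-- The exceptional null set depends on `c`, and `γ` may be uncountable, but `r` takes only finitely
many values. -/
theorem ae_of_forall_simpleFunc {γ : Type*} (r : SimpleFunc X γ) {Q : γ → X → Prop}
    (h : ∀ c, ∀ᵐ x ∂m, Q c x) : ∀ᵐ x ∂m, Q (r x) x := by
  filter_upwards [(Filter.eventually_all_finset r.range).2 fun c _ => h c] with x hx
  exact hx _ (r.mem_range_self x)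

theorem exists_ae_abs_le (f : LInfty m) :
    ∃ C : ℝ, 0 ≤ C ∧ ∀ᵐ x ∂m, |(f : X →ₘ[m] ℝ) x| ≤ C := by
  have hf : MemLp (f : X →ₘ[m] ℝ) ∞ m := f.2
  refine ⟨(eLpNorm (f : X →ₘ[m] ℝ) ∞ m).toReal, ENNReal.toReal_nonneg, ?_⟩
  filter_upwards [enorm_ae_le_eLpNormEssSup (f : X →ₘ[m] ℝ) m] with x hx
  rw [← eLpNorm_exponent_top] at hx
  have := ENNReal.toReal_mono hf.2.ne hx
  simpa using this

/-- Bounded functions are uniform limits of simple functions. -/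
theorem exists_simpleFunc_ae_abs_sub_le (f : LInfty m) {ε : ℝ} (hε : 0 < ε) :
    ∃ s : SimpleFunc X ℝ, ∀ᵐ x ∂m, |(f : X →ₘ[m] ℝ) x - s x| ≤ ε := by
  obtain ⟨C, hC0, hC⟩ := exists_ae_abs_le f
  -- Truncation changes `f` only on a null set and bounds it everywhere, so that rounding down to
  -- multiples of `ε` leaves finitely many values.
  let F : X → ℝ := fun x => max (-C) (min ((f : X →ₘ[m] ℝ) x) C)
  have hF : Measurable F :=
    measurable_const.max ((f : X →ₘ[m] ℝ).stronglyMeasurable.measurable.min measurable_const)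
  have hg : Measurable fun x => ⌊F x / ε⌋ := (hF.div_const ε).floor
  let g : SimpleFunc X ℤ :=
    { toFun := fun x => ⌊F x / ε⌋
      measurableSet_fiber' := fun k => hg (measurableSet_singleton k)
      finite_range' := by
        refine (Set.finite_Icc ⌊-C / ε⌋ ⌊C / ε⌋).subset ?_
        rintro _ ⟨x, rfl⟩
        refine ⟨Int.floor_le_floor ?_, Int.floor_le_floor ?_⟩
        · exact div_le_div_of_nonneg_right (le_max_left _ _) hε.le
        · exact div_le_div_of_nonneg_right (max_le (by linarith) (min_le_right _ _)) hε.le }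
  refine ⟨g.map fun k : ℤ => ε * (k : ℝ), ?_⟩
  filter_upwards [hC] with x hx
  have hFx : F x = (f : X →ₘ[m] ℝ) x := by
    simp only [F]
    rw [min_eq_left (abs_le.1 hx).2, max_eq_right (abs_le.1 hx).1]
  have h1 := Int.floor_le (F x / ε)
  have h2 := Int.lt_floor_add_one (F x / ε)
  rw [le_div_iff₀ hε] at h1
  rw [div_lt_iff₀ hε] at h2
  have h3 : (g.map fun k : ℤ => ε * (k : ℝ)) x = ε * (⌊F x / ε⌋ : ℝ) := rfl
  rw [h3, ← hFx, abs_le]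
  constructor <;> linarith

end SimpleClass

/-! ### Normed modules and step forms -/

namespace LpNormedModule

variable {X : Type u} [MeasurableSpace X] {p : ℝ≥0∞} {m : Measure X}
  (M : LpNormedModule.{u, v} p m)

theorem norm_smul_le_of_ae_abs_le {f : LInfty m} {C : ℝ} (hC : 0 ≤ C)
    (hf : ∀ᵐ x ∂m, |(f : X →ₘ[m] ℝ) x| ≤ C) (v : M) : ‖f • v‖ ≤ C * ‖v‖ := by
  have h2 := eLpNorm_le_nnreal_smul_eLpNorm_of_ae_le_mul' (p := p) (μ := m)
    (f := M.ptNorm (f • v)) (g := M.ptNorm v) (c := C.toNNReal) (by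
      filter_upwards [M.ptNorm_smul f v, hf] with x hx hx'
      rw [enorm_eq_self, enorm_eq_self, hx]
      gcongr
      rw [← ofReal_norm]
      exact ENNReal.ofReal_le_ofReal hx')
  rw [← M.enorm_eq, ← M.enorm_eq, ENNReal.smul_def, smul_eq_mul] at h2
  have h3 := ENNReal.toReal_mono (by finiteness) h2
  simpa [hC] using h3

theorem norm_chi_smul_le {B : Set X} (hB : MeasurableSet B) (v : M) :
    ‖LInfty.chi m hB • v‖ ≤ ‖v‖ := by
  refine (M.norm_smul_le_of_ae_abs_le zero_le_one ?_ v).trans_eq (one_mul _)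
  filter_upwards [coeFn_chi (m := m) hB] with x hx
  rw [hx]
  by_cases h : x ∈ B <;> simp [h]

theorem smul_real_smul (f : LInfty m) (c : ℝ) (v : M) : f • c • v = c • f • v := by
  rw [← M.const_smul_eq, ← M.const_smul_eq, smul_comm]

theorem continuous_chi_smul {B : Set X} (hB : MeasurableSet B) :
    Continuous fun v : M => LInfty.chi m hB • v := by
  refine LipschitzWith.continuous (K := 1) (LipschitzWith.of_dist_le_mul fun v w => ?_)
  rw [dist_eq_norm, dist_eq_norm, ← smul_sub]
  simpa using M.norm_chi_smul_le hB (v - w)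

theorem eLpNorm_ptNorm_chi_smul {B : Set X} (hB : MeasurableSet B) (v : M) :
    ‖LInfty.chi m hB • v‖ₑ = eLpNorm (M.ptNorm v) p (m.restrict B) := by
  rw [M.enorm_eq, ← eLpNorm_indicator_eq_eLpNorm_restrict hB]
  refine eLpNorm_congr_ae ?_
  filter_upwards [M.ptNorm_smul (LInfty.chi m hB) v, coeFn_chi (m := m) hB] with x h1 h2
  rw [h1, h2]
  by_cases h : x ∈ B <;> simp [h]

variable {M} {N : LpNormedModule.{u, w} p m}

/-- The pointwise norm of `v` is determined by the norms of all `χ_B v`. -/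
theorem ptNorm_eq_of_norm_chi_smul_eq (hp0 : p ≠ 0) (hp : p ≠ ∞) {v : M} {w : N}
    (h : ∀ (B : Set X) (hB : MeasurableSet B),
      ‖LInfty.chi m hB • v‖ = ‖LInfty.chi m hB • w‖) : M.ptNorm v = N.ptNorm w := by
  have hpos := ENNReal.toReal_pos hp0 hp
  have hfin : ∫⁻ x, M.ptNorm v x ^ p.toReal ∂m ≠ ∞ := by
    refine ((memLp_iff_lintegral_rpow_lt_top hp0 hp _).1 ⟨AEEqFun.aestronglyMeasurable _, ?_⟩).ne
    rw [← M.enorm_eq]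
    exact enorm_lt_top
  -- The norm of `χ_B v` is the `L^p` norm of the pointwise norm over `B`; the integrals of its
  -- `p`-th power over all `B` determine that power a.e.
  have hkey := AEMeasurable.ae_eq_of_forall_setLIntegral_eq (μ := m)
    ((M.ptNorm v).aestronglyMeasurable.aemeasurable.pow_const p.toReal)
    ((N.ptNorm w).aestronglyMeasurable.aemeasurable.pow_const p.toReal) hfin
    (by
      refine ((memLp_iff_lintegral_rpow_lt_top hp0 hp _).1
        ⟨AEEqFun.aestronglyMeasurable _, ?_⟩).ne
      rw [← N.enorm_eq]
      exact enorm_lt_top)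
    (fun B hB _ => by
      have h1 : ‖LInfty.chi m hB • v‖ₑ = ‖LInfty.chi m hB • w‖ₑ := by
        rw [← ofReal_norm, ← ofReal_norm, h B hB]
      rw [M.eLpNorm_ptNorm_chi_smul, N.eLpNorm_ptNorm_chi_smul,
        eLpNorm_eq_lintegral_rpow_enorm_toReal hp0 hp,
        eLpNorm_eq_lintegral_rpow_enorm_toReal hp0 hp] at h1
      simpa using (ENNReal.rpow_left_injective (one_div_pos.2 hpos).ne') h1)
  refine AEEqFun.ext ?_
  filter_upwards [hkey] with x hx
  exact ENNReal.rpow_left_injective hpos.ne' hx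

/-- A bounded linear map that commutes with characteristic functions is `L^∞(m)`-linear. -/
theorem map_smul_of_map_chi_smul (T : M →L[ℝ] N)
    (hT : ∀ (B : Set X) (hB : MeasurableSet B) (v : M),
      T (LInfty.chi m hB • v) = LInfty.chi m hB • T v) (f : LInfty m) (v : M) :
    T (f • v) = f • T v := by
  have hs : ∀ s : SimpleFunc X ℝ, T (simpleClass m s • v) = simpleClass m s • T v := by
    intro s
    rw [simpleClass_eq_sum, Finset.sum_smul, Finset.sum_smul, map_sum]
    refine Finset.sum_congr rfl fun c _ => ?_
    rw [mul_smul, mul_smul, M.const_smul_eq, N.const_smul_eq, map_smul, hT]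
  rw [← sub_eq_zero, ← norm_le_zero_iff]
  refine le_of_forall_pos_le_add fun δ hδ => ?_
  set K := ‖T‖ * ‖v‖ + ‖T v‖ with hK
  have hK0 : 0 ≤ K := by positivity
  obtain ⟨s, hs'⟩ := exists_simpleFunc_ae_abs_sub_le f (ε := δ / (K + 1)) (by positivity)
  have hfs : ∀ᵐ x ∂m, |((f - simpleClass m s : LInfty m) : X →ₘ[m] ℝ) x| ≤ δ / (K + 1) := by
    filter_upwards [hs', coeFn_LInfty_sub f (simpleClass m s), coeFn_simpleClass (m := m) s]
      with x h1 h2 h3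
    rwa [h2, h3]
  -- Simple functions already commute with `T`, so only the remainder `f - s` contributes, with
  -- error at most `δ / (K + 1) * K`.
  have e : T (f • v) - f • T v =
      T ((f - simpleClass m s) • v) - (f - simpleClass m s) • T v := by
    rw [sub_smul, sub_smul, map_sub, hs]
    abel
  rw [e, zero_add]
  have h1 : ‖T ((f - simpleClass m s) • v)‖ ≤ ‖T‖ * (δ / (K + 1) * ‖v‖) :=
    (T.le_opNorm _).trans (mul_le_mul_of_nonneg_left
      (M.norm_smul_le_of_ae_abs_le (by positivity) hfs v) (norm_nonneg _))
  have h2 := N.norm_smul_le_of_ae_abs_le (by positivity) hfs (T v)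
  calc _ ≤ ‖T‖ * (δ / (K + 1) * ‖v‖) + δ / (K + 1) * ‖T v‖ :=
        (norm_sub_le _ _).trans (add_le_add h1 h2)
    _ = δ / (K + 1) * K := by rw [hK]; ring
    _ ≤ δ := by
        rw [div_mul_eq_mul_div, div_le_iff₀ (by positivity)]
        nlinarith

/-- Elements that agree on the fibres of a simple function are equal. -/
theorem ext_of_chi_fiber_smul {γ : Type*} (r : SimpleFunc X γ) {v w : M}
    (h : ∀ c, LInfty.chi m (r.measurableSet_fiber c) • v =
      LInfty.chi m (r.measurableSet_fiber c) • w) : v = w := by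
  rw [← one_smul (LInfty m) v, ← one_smul (LInfty m) w, ← sum_chi_fiber r, Finset.sum_smul,
    Finset.sum_smul]
  exact Finset.sum_congr rfl fun c _ => h c

variable {V : Type*} [AddCommGroup V] [Module ℝ V]

/-- Locality of step forms: on a set where `s` is constant only one summand survives. If `c` is not
a value of `s`, then `A` is empty and both sides vanish. -/
theorem chi_smul_sum_fiber (d : V →ₗ[ℝ] M) (s : SimpleFunc X V) {A : Set X}
    (hA : MeasurableSet A) {c : V} (hs : ∀ x ∈ A, s x = c) :
    LInfty.chi m hA • ∑ b ∈ s.range, LInfty.chi m (s.measurableSet_fiber b) • d b =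
      LInfty.chi m hA • d c := by
  have h0 : ∀ b, b ≠ c → LInfty.chi m hA * LInfty.chi m (s.measurableSet_fiber b) = 0 :=
    fun b hb => chi_mul_chi_of_disjoint _ _ (disjoint_left.2 fun x hx hxb =>
      hb ((mem_singleton_iff.1 hxb).symm.trans (hs x hx)))
  have h1 : LInfty.chi m hA * LInfty.chi m (s.measurableSet_fiber c) = LInfty.chi m hA :=
    chi_mul_chi_of_subset _ _ hs
  rw [Finset.smul_sum, Finset.sum_eq_single c]
  · rw [smul_smul, h1]
  · intro b _ hb
    rw [smul_smul, h0 b hb, zero_smul]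
  · intro hc
    have : A = ∅ := eq_empty_of_forall_notMem fun x hx => hc (hs x hx ▸ s.mem_range_self x)
    have h2 : LInfty.chi m hA * LInfty.chi m hA = 0 :=
      chi_mul_chi_of_disjoint _ _ (by simp [this])
    rw [chi_mul_chi_of_subset hA hA Subset.rfl] at h2
    rw [h2, zero_smul]

/-- The form `∑ χ_{s = v} dv` associated to a simple function `s` with values in the domain of
a differential `d`. -/
def stepForm (d : V →ₗ[ℝ] M) : SimpleFunc X V →ₗ[ℝ] M where
  toFun s := ∑ b ∈ s.range, LInfty.chi m (s.measurableSet_fiber b) • d b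
  map_add' s t := by
    -- The fibres of the pair form a common refinement on which `s`, `t` and `s + t` are all
    -- constant.
    refine ext_of_chi_fiber_smul (s.pair t) fun c => ?_
    have hc : ∀ x ∈ s.pair t ⁻¹' {c}, (s x, t x) = c := fun x hx => hx
    rw [smul_add, chi_smul_sum_fiber d s _ (c := c.1) fun x hx => by rw [← hc x hx],
      chi_smul_sum_fiber d t _ (c := c.2) fun x hx => by rw [← hc x hx],
      chi_smul_sum_fiber d (s + t) _ (c := c.1 + c.2) fun x hx => by rw [← hc x hx]; rfl,
      map_add, smul_add]
  map_smul' a s := by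
    refine ext_of_chi_fiber_smul s fun c => ?_
    have hc : ∀ x ∈ s ⁻¹' {c}, s x = c := fun x hx => hx
    rw [RingHom.id_apply, M.smul_real_smul, chi_smul_sum_fiber d s _ hc,
      chi_smul_sum_fiber d (a • s) _ (c := a • c) fun x hx => by rw [← hc x hx]; rfl,
      map_smul, M.smul_real_smul]

theorem chi_smul_stepForm_of_eqOn (d : V →ₗ[ℝ] M) (s : SimpleFunc X V) {A : Set X}
    (hA : MeasurableSet A) {c : V} (hs : ∀ x ∈ A, s x = c) :
    LInfty.chi m hA • stepForm d s = LInfty.chi m hA • d c :=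
  chi_smul_sum_fiber d s hA hs

theorem stepForm_const (d : V →ₗ[ℝ] M) (c : V) : stepForm d (SimpleFunc.const X c) = d c :=
  ext_of_chi_fiber_smul (SimpleFunc.const X c) fun _ =>
    chi_smul_stepForm_of_eqOn d _ _ fun _ _ => rfl

theorem chi_smul_stepForm (d : V →ₗ[ℝ] M) (s : SimpleFunc X V) {B : Set X}
    (hB : MeasurableSet B) :
    LInfty.chi m hB • stepForm d s =
      stepForm d (SimpleFunc.piecewise B hB s (SimpleFunc.const X 0)) := by
  classical
  -- On each fibre both `χ_B` and `s` are constant, and the fibre lies inside `B` or is disjoint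
  -- from it according to whether `c.1 = 1`.
  refine ext_of_chi_fiber_smul ((simpleChi hB).pair s) fun c => ?_
  have hc : ∀ x ∈ (simpleChi hB).pair s ⁻¹' {c}, (simpleChi hB x, s x) = c := fun x hx => hx
  have hs : ∀ x ∈ (simpleChi hB).pair s ⁻¹' {c}, s x = c.2 := fun x hx => by rw [← hc x hx]
  by_cases h : c.1 = 1
  · have hsub : (simpleChi hB).pair s ⁻¹' {c} ⊆ B := fun x hx => by
      by_contra hxB
      have : simpleChi hB x = c.1 := by rw [← hc x hx]
      simp [simpleChi_apply, hxB, h] at this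
    rw [smul_smul, chi_mul_chi_of_subset _ _ hsub, chi_smul_stepForm_of_eqOn d s _ hs,
      chi_smul_stepForm_of_eqOn d _ _ fun x hx => ?_]
    rw [SimpleFunc.coe_piecewise, Set.piecewise_eq_of_mem _ _ _ (hsub hx), hs x hx]
  · have hdis : ∀ x ∈ (simpleChi hB).pair s ⁻¹' {c}, x ∉ B := fun x hx hxB => by
      have : simpleChi hB x = c.1 := by rw [← hc x hx]
      rw [simpleChi_apply, indicator_of_mem hxB] at this
      exact h this.symm
    rw [smul_smul, chi_mul_chi_of_disjoint _ _ (disjoint_left.2 hdis), zero_smul,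
      chi_smul_stepForm_of_eqOn d _ _ (c := 0) fun x hx => ?_, map_zero, smul_zero]
    rw [SimpleFunc.coe_piecewise, Set.piecewise_eq_of_notMem _ _ _ (hdis x hx)]
    rfl

/-- Multiplying by the characteristic function of a fibre turns the step form into a single
differential, and `ptNorm_smul` localises the norm to that fibre. Thus the pointwise norms of
differentials determine the norms of all step forms. -/
theorem ptNorm_stepForm (d : V →ₗ[ℝ] M) (s : SimpleFunc X V) :
    ∀ᵐ x ∂m, M.ptNorm (stepForm d s) x = M.ptNorm (d (s x)) x := by
  have h : ∀ c, ∀ᵐ x ∂m, s x = c →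
      M.ptNorm (stepForm d s) x = M.ptNorm (d c) x := by
    intro c
    have h := chi_smul_stepForm_of_eqOn d s (s.measurableSet_fiber c) (fun x hx => hx)
    filter_upwards [M.ptNorm_smul (LInfty.chi m (s.measurableSet_fiber c)) (stepForm d s),
      M.ptNorm_smul (LInfty.chi m (s.measurableSet_fiber c)) (d c),
      coeFn_chi (m := m) (s.measurableSet_fiber c)] with x h1 h2 h3 hx
    rw [h, h2, h3, indicator_of_mem (by exact hx)] at h1
    simpa using h1.symm
  filter_upwards [ae_of_forall_simpleFunc s h] with x hx using hx rfl

/-- Two modules in which the forms `∑ χ_{B_i} dv_i` are dense, with the same pointwise norms of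
differentials, are isomorphic in a unique way. -/
theorem existsUnique_equiv (hp0 : p ≠ 0) (hp : p ≠ ∞) (d : V →ₗ[ℝ] M) (d' : V →ₗ[ℝ] N)
    (hd : DenseRange (stepForm d)) (hd' : DenseRange (stepForm d'))
    (h : ∀ c, N.ptNorm (d' c) = M.ptNorm (d c)) :
    ∃! Φ : M ≃ₗ[LInfty m] N,
      (∀ ω : M, N.ptNorm (Φ ω) = M.ptNorm ω) ∧ ∀ c, Φ (d c) = d' c := by
  have hnorm : ∀ s : SimpleFunc X V,
      ‖stepForm d' (LinearEquiv.refl ℝ (SimpleFunc X V) s)‖ = ‖stepForm d s‖ := by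
    intro s
    have h1 : ‖stepForm d' s‖ₑ = ‖stepForm d s‖ₑ := by
      rw [N.enorm_eq, M.enorm_eq]
      refine eLpNorm_congr_ae ?_
      filter_upwards [ptNorm_stepForm d s, ptNorm_stepForm d' s] with x h1 h2
      rw [h1, h2, h]
    simpa using congrArg ENNReal.toReal h1
  -- Both dense subspaces are parametrised by the same simple functions with equal norms, so the
  -- identity on parameters induces the isometry.
  let e := (LinearEquiv.refl ℝ (SimpleFunc X V)).extendOfIsometry (stepForm d) (stepForm d')
    hd hd' hnorm
  have he : ∀ s, e (stepForm d s) = stepForm d' s := fun s =>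
    LinearEquiv.extendOfIsometry_eq _ _ _ hd hd' hnorm s
  have hchi : ∀ (B : Set X) (hB : MeasurableSet B) (v : M),
      e (LInfty.chi m hB • v) = LInfty.chi m hB • e v := by
    intro B hB v
    refine hd.induction_on (p := fun v => e (LInfty.chi m hB • v) = LInfty.chi m hB • e v) v
      (isClosed_eq (e.continuous.comp (M.continuous_chi_smul hB))
        ((N.continuous_chi_smul hB).comp e.continuous)) fun s => ?_
    rw [he, chi_smul_stepForm, chi_smul_stepForm, he]
  have hsmul := map_smul_of_map_chi_smul
    (T := (e.toContinuousLinearEquiv : M →L[ℝ] N)) hchi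
  let Φ : M ≃ₗ[LInfty m] N :=
    { e.toLinearEquiv with
      map_smul' := hsmul }
  have hΦ : ∀ v, Φ v = e v := fun _ => rfl
  refine ⟨Φ, ⟨fun ω => ?_, fun c => ?_⟩, ?_⟩
  · refine ptNorm_eq_of_norm_chi_smul_eq hp0 hp fun B hB => ?_
    rw [hΦ, ← hchi, e.norm_map]
  · rw [hΦ, ← stepForm_const (X := X) d c, he, stepForm_const]
  · rintro Ψ ⟨hΨ, hΨd⟩
    have hiso : ∀ v, ‖Ψ v‖ = ‖v‖ := fun v => by
      have h1 : ‖Ψ v‖ₑ = ‖v‖ₑ := by rw [N.enorm_eq, M.enorm_eq, hΨ]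
      simpa using congrArg ENNReal.toReal h1
    have hc : Continuous Ψ := AddMonoidHomClass.continuous_of_bound Ψ 1 fun v => by
      rw [hiso, one_mul]
    -- Linearity over `L^∞(m)` and the values on differentials fix `Ψ` on step forms; continuity and
    -- density do the rest.
    have heq : (Ψ : M → N) = e := hd.equalizer hc e.continuous (funext fun s => by
      simp only [Function.comp_apply, he]
      simp only [stepForm, LinearMap.coe_mk, AddHom.coe_mk, map_sum, map_smul, hΨd])
    exact LinearEquiv.ext fun v => congrFun heq v

end LpNormedModule

/-! ### Simple forms as step forms -/

namespace DStructure

variable {X : Type u} [MetricSpace X] [MeasurableSpace X] {p : ℝ≥0∞} {m : Measure X}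
  {D : DStructure p m}

/-- The fibres of a simple function are a finite Borel partition; conversely each `χ_B du` is the
step form of the function equal to `u` on `B` and to `0` elsewhere. -/
theorem simpleForms_eq_range_stepForm (M : LpNormedModule.{u, v} p m)
    (d : D.sobolevClass →ₗ[ℝ] M) :
    D.simpleForms M d = LinearMap.range (LpNormedModule.stepForm (V := D.sobolevClass) d) := by
  refine le_antisymm ?_ ?_
  · rintro _ ⟨n, B, hB, u, -, -, rfl⟩
    refine Submodule.sum_mem _ fun i _ => ?_
    rw [← LpNormedModule.stepForm_const (X := X) d (u i), LpNormedModule.chi_smul_stepForm]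
    exact LinearMap.mem_range_self _ _
  · rintro _ ⟨s, rfl⟩
    let e := s.range.equivFin
    refine ⟨s.range.card, fun i => s ⁻¹' {(e.symm i : D.sobolevClass)},
      fun i => s.measurableSet_fiber _, fun i => e.symm i, fun i j hij => ?_, ?_, ?_⟩
    · refine disjoint_left.2 fun x hi hj => hij (e.symm.injective (Subtype.ext ?_))
      exact (mem_singleton_iff.1 hi).symm.trans (mem_singleton_iff.1 hj)
    · refine eq_univ_of_forall fun x => mem_iUnion.2 ⟨e ⟨s x, s.mem_range_self x⟩, ?_⟩
      simp
    · rw [e.symm.sum_comp (fun b : s.range =>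
        LInfty.chi m (s.measurableSet_fiber (b : D.sobolevClass)) • d b)]
      exact (Finset.sum_coe_sort s.range
        (fun b => LInfty.chi m (s.measurableSet_fiber b) • d b)).symm

end DStructure

/-! ### Extension of representations from simple functions to bounded functions -/

section Extension

variable {X : Type u} [MeasurableSpace X] {m : Measure X}
  {𝒜 : Type*} [NormedRing 𝒜] [CompleteSpace 𝒜]

/-- A ring homomorphism from simple functions to a complete normed ring which is bounded for the
essential supremum norm has values approximating a value at every bounded function. -/
theorem exists_norm_sub_simple_le (T : SimpleFunc X ℝ →+* 𝒜)
    (hT : ∀ (s : SimpleFunc X ℝ) (C : ℝ), 0 ≤ C → (∀ᵐ x ∂m, |s x| ≤ C) → ‖T s‖ ≤ C)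
    (f : LInfty m) :
    ∃ A : 𝒜, ∀ (s : SimpleFunc X ℝ) (C : ℝ), 0 ≤ C →
      (∀ᵐ x ∂m, |(f : X →ₘ[m] ℝ) x - s x| ≤ C) → ‖A - T s‖ ≤ C := by
  have hdiff : ∀ (s t : SimpleFunc X ℝ) (C E : ℝ), 0 ≤ C → 0 ≤ E →
      (∀ᵐ x ∂m, |(f : X →ₘ[m] ℝ) x - s x| ≤ C) → (∀ᵐ x ∂m, |(f : X →ₘ[m] ℝ) x - t x| ≤ E) →
      ‖T s - T t‖ ≤ C + E := by
    intro s t C E hC hE hs ht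
    rw [← map_sub]
    refine hT _ _ (add_nonneg hC hE) ?_
    filter_upwards [hs, ht] with x h1 h2
    rw [SimpleFunc.coe_sub, Pi.sub_apply]
    rw [abs_le] at *
    constructor <;> linarith
  choose s hs using fun n : ℕ =>
    exists_simpleFunc_ae_abs_sub_le f (Nat.one_div_pos_of_nat (α := ℝ) (n := n))
  have h0 : ∀ n : ℕ, (0 : ℝ) ≤ 1 / ((n : ℝ) + 1) := fun n => by positivity
  have hcauchy : CauchySeq fun n => T (s n) := by
    refine cauchySeq_of_le_tendsto_0 (fun n : ℕ => 1 / ((n : ℝ) + 1) + 1 / ((n : ℝ) + 1))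
      (fun i j n hi hj => ?_) ?_
    · rw [dist_eq_norm]
      exact (hdiff _ _ _ _ (h0 i) (h0 j) (hs i) (hs j)).trans
        (add_le_add (Nat.one_div_le_one_div hi) (Nat.one_div_le_one_div hj))
    · simpa using (tendsto_one_div_add_atTop_nhds_zero_nat (𝕜 := ℝ)).add
        (tendsto_one_div_add_atTop_nhds_zero_nat (𝕜 := ℝ))
  obtain ⟨A, hA⟩ := cauchySeq_tendsto_of_complete hcauchy
  refine ⟨A, fun t C hC ht => ?_⟩
  have h1 : Tendsto (fun n => ‖T (s n) - T t‖) atTop (𝓝 ‖A - T t‖) :=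
    (hA.sub tendsto_const_nhds).norm
  have h2 : Tendsto (fun n : ℕ => 1 / ((n : ℝ) + 1) + C) atTop (𝓝 (0 + C)) :=
    tendsto_one_div_add_atTop_nhds_zero_nat.add tendsto_const_nhds
  rw [zero_add] at h2
  exact le_of_tendsto_of_tendsto' h1 h2 fun n => hdiff _ _ _ _ (h0 n) hC (hs n) ht

/-- A ring homomorphism from simple functions to a complete normed ring which is bounded for the
essential supremum norm extends to `L^∞(m)`. -/
theorem exists_LInfty_ringHom (T : SimpleFunc X ℝ →+* 𝒜)
    (hT : ∀ (s : SimpleFunc X ℝ) (C : ℝ), 0 ≤ C → (∀ᵐ x ∂m, |s x| ≤ C) → ‖T s‖ ≤ C) :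
    ∃ A : LInfty m →+* 𝒜, ∀ (f : LInfty m) (s : SimpleFunc X ℝ) (C : ℝ), 0 ≤ C →
      (∀ᵐ x ∂m, |(f : X →ₘ[m] ℝ) x - s x| ≤ C) → ‖A f - T s‖ ≤ C := by
  choose A hA using fun f : LInfty m => exists_norm_sub_simple_le T hT f
  -- The tolerance `C = 0` is admissible, which turns the approximation into equality.
  have hsimple : ∀ s, A (simpleClass m s) = T s := fun s => by
    rw [← sub_eq_zero, ← norm_le_zero_iff]
    refine hA _ s 0 le_rfl ?_
    filter_upwards [coeFn_simpleClass (m := m) s] with x hx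
    simp [hx]
  have hadd : ∀ f g, A (f + g) = A f + A g := by
    intro f g
    rw [← sub_eq_zero, ← norm_le_zero_iff]
    refine le_of_forall_pos_le_add fun ε hε => ?_
    obtain ⟨s, hs⟩ := exists_simpleFunc_ae_abs_sub_le f (ε := ε / 4) (by positivity)
    obtain ⟨t, ht⟩ := exists_simpleFunc_ae_abs_sub_le g (ε := ε / 4) (by positivity)
    have h1 := hA f s _ (by positivity) hs
    have h2 := hA g t _ (by positivity) ht
    have h3 := hA (f + g) (s + t) (ε / 4 + ε / 4) (by positivity) (by
      filter_upwards [hs, ht, AEEqFun.coeFn_add (f : X →ₘ[m] ℝ) (g : X →ₘ[m] ℝ)] with x k1 k2 k3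
      rw [Subring.coe_add, k3, Pi.add_apply, SimpleFunc.coe_add, Pi.add_apply]
      rw [abs_le] at *
      constructor <;> linarith)
    have e : A (f + g) - (A f + A g) =
        (A (f + g) - T (s + t)) - (A f - T s) - (A g - T t) := by rw [map_add]; abel
    rw [e]
    have h4 := norm_sub_le (A (f + g) - T (s + t) - (A f - T s)) (A g - T t)
    have h5 := norm_sub_le (A (f + g) - T (s + t)) (A f - T s)
    linarith
  have hmul : ∀ f g, A (f * g) = A f * A g := by
    intro f g
    obtain ⟨K, hK0, hK⟩ := exists_ae_abs_le f
    obtain ⟨L, hL0, hL⟩ := exists_ae_abs_le g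
    rw [← sub_eq_zero, ← norm_le_zero_iff]
    refine le_of_forall_pos_le_add fun δ hδ => ?_
    -- `R` collects the coefficients of `ε` in the three error terms below; `ε ≤ 1` is what bounds
    -- `t` by `L + 1`.
    set R := K + 2 * (L + 1) + ‖A f‖ with hR
    have hR0 : 0 < R := by positivity
    obtain ⟨ε, hε, hε1, hεR⟩ : ∃ ε : ℝ, 0 < ε ∧ ε ≤ 1 ∧ ε * R ≤ δ :=
      ⟨min 1 (δ / R), by positivity, min_le_left _ _,
        (le_div_iff₀ hR0).1 (min_le_right _ _)⟩
    obtain ⟨s, hs⟩ := exists_simpleFunc_ae_abs_sub_le f hε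
    obtain ⟨t, ht⟩ := exists_simpleFunc_ae_abs_sub_le g hε
    have htL : ∀ᵐ x ∂m, |t x| ≤ L + 1 := by
      filter_upwards [hL, ht] with x k1 k2
      rw [abs_le] at *
      constructor <;> linarith
    have h1 := hA f s _ hε.le hs
    have h2 := hA g t _ hε.le ht
    have h3 := hA (f * g) (s * t) (K * ε + ε * (L + 1)) (by positivity) (by
      filter_upwards [hs, ht, hK, htL, AEEqFun.coeFn_mul (f : X →ₘ[m] ℝ) (g : X →ₘ[m] ℝ)]
        with x k1 k2 k3 k4 k5
      rw [Subring.coe_mul, k5, Pi.mul_apply, SimpleFunc.coe_mul, Pi.mul_apply]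
      have e : (f : X →ₘ[m] ℝ) x * (g : X →ₘ[m] ℝ) x - s x * t x =
        (f : X →ₘ[m] ℝ) x * ((g : X →ₘ[m] ℝ) x - t x) +
          ((f : X →ₘ[m] ℝ) x - s x) * t x := by ring
      rw [e]
      refine (abs_add_le _ _).trans ?_
      rw [abs_mul, abs_mul]
      gcongr)
    have h4 := hT t (L + 1) (by positivity) htL
    have e : A (f * g) - A f * A g =
        (A (f * g) - T (s * t)) - A f * (A g - T t) - (A f - T s) * T t := by
      rw [map_mul]; noncomm_ring
    rw [e, zero_add]
    calc _ ≤ ‖A (f * g) - T (s * t)‖ + ‖A f * (A g - T t)‖ + ‖(A f - T s) * T t‖ :=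
          (norm_sub_le _ _).trans (by gcongr; exact norm_sub_le _ _)
      _ ≤ (K * ε + ε * (L + 1)) + ‖A f‖ * ε + ε * (L + 1) := by
          gcongr
          · exact (norm_mul_le _ _).trans (by gcongr)
          · exact (norm_mul_le _ _).trans (by gcongr)
      _ = ε * R := by rw [hR]; ring
      _ ≤ δ := hεR
  exact ⟨{ toFun := A
           map_one' := by rw [← map_one (simpleClass m), hsimple, map_one]
           map_mul' := hmul
           map_zero' := by rw [← map_zero (simpleClass m), hsimple, map_zero]
           map_add' := hadd }, hA⟩

end Extension

/-! ### The module generated by a pointwise seminorm -/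

/-- A seminorm on `V` with values in the non-negative functions of `L^p(m)`. -/
structure PointwiseSeminorm {X : Type u} [MeasurableSpace X] (V : Type v) [AddCommGroup V]
    [Module ℝ V] (p : ℝ≥0∞) (m : Measure X) where
  /-- a representative of the value of the seminorm -/
  toFun : V → X → ℝ
  measurable : ∀ v, Measurable (toFun v)
  nonneg : ∀ v x, 0 ≤ toFun v x
  memLp : ∀ v, MemLp (toFun v) p m
  add_le : ∀ v w, ∀ᵐ x ∂m, toFun (v + w) x ≤ toFun v x + toFun w x
  smul_eq : ∀ (c : ℝ) v, ∀ᵐ x ∂m, toFun (c • v) x = |c| * toFun v x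

namespace PointwiseSeminorm

variable {X : Type u} [MeasurableSpace X] {V : Type v} [AddCommGroup V]
  [Module ℝ V] {p : ℝ≥0∞} {m : Measure X}

/-- The simple functions with values in the domain of a pointwise seminorm. -/
def Step (_ : PointwiseSeminorm V p m) : Type (max u v) := SimpleFunc X V

variable (P : PointwiseSeminorm V p m)

instance : AddCommGroup P.Step := inferInstanceAs (AddCommGroup (SimpleFunc X V))

instance : Module ℝ P.Step := inferInstanceAs (Module ℝ (SimpleFunc X V))

instance : FunLike P.Step X V := inferInstanceAs (FunLike (SimpleFunc X V) X V)

/-- Dominated by the finite sum of the seminorms of all values of `f`. -/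
theorem memLp_step (f : P.Step) : MemLp (fun x => P.toFun (f x) x) p m := by
  have hm : Measurable fun x => P.toFun (f x) x :=
    SimpleFunc.measurable_bind (f : SimpleFunc X V) P.toFun P.measurable
  refine (memLp_finsetSum (SimpleFunc.range (f : SimpleFunc X V))
    fun v _ => P.memLp v).mono hm.aestronglyMeasurable (Eventually.of_forall fun x => ?_)
  rw [Real.norm_of_nonneg (P.nonneg _ _),
    Real.norm_of_nonneg (Finset.sum_nonneg fun _ _ => P.nonneg _ _)]
  exact Finset.single_le_sum (f := fun v => P.toFun v x) (fun v _ => P.nonneg v x)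
    (SimpleFunc.mem_range_self (f : SimpleFunc X V) x)

/-- The pointwise norm of a simple function. -/
def stepNorm (f : P.Step) : Lp ℝ p m := (P.memLp_step f).toLp

theorem coeFn_stepNorm (f : P.Step) : P.stepNorm f =ᵐ[m] fun x => P.toFun (f x) x :=
  (P.memLp_step f).coeFn_toLp

theorem stepNorm_nonneg (f : P.Step) : 0 ≤ P.stepNorm f := by
  rw [← Lp.coeFn_nonneg]
  filter_upwards [P.coeFn_stepNorm f] with x hx
  rw [hx]
  exact P.nonneg _ _

instance : Norm P.Step := ⟨fun f => ‖P.stepNorm f‖⟩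

theorem norm_step_def (f : P.Step) : ‖f‖ = ‖P.stepNorm f‖ := rfl

theorem ae_step_add_le (f g : P.Step) :
    ∀ᵐ x ∂m, P.toFun ((f + g) x) x ≤ P.toFun (f x) x + P.toFun (g x) x :=
  ae_of_forall_simpleFunc (SimpleFunc.pair (f : SimpleFunc X V) g)
    (Q := fun c x => P.toFun (c.1 + c.2) x ≤ P.toFun c.1 x + P.toFun c.2 x)
    fun c => P.add_le c.1 c.2

theorem ae_step_smul_eq (c : ℝ) (f : P.Step) :
    ∀ᵐ x ∂m, P.toFun ((c • f) x) x = |c| * P.toFun (f x) x :=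
  ae_of_forall_simpleFunc (f : SimpleFunc X V)
    (Q := fun v x => P.toFun (c • v) x = |c| * P.toFun v x) fun v => P.smul_eq c v

/-- The action of the real simple functions on the simple functions with values in `V`. -/
def simpleSmul (s : SimpleFunc X ℝ) (f : P.Step) : P.Step :=
  (s.pair (f : SimpleFunc X V)).map fun q => q.1 • q.2

theorem simpleSmul_apply (s : SimpleFunc X ℝ) (f : P.Step) (x : X) :
    P.simpleSmul s f x = s x • f x := rfl

theorem step_ext {f g : P.Step} (h : ∀ x, f x = g x) : f = g :=
  SimpleFunc.ext h

theorem ae_toFun_simpleSmul (s : SimpleFunc X ℝ) (f : P.Step) :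
    ∀ᵐ x ∂m, P.toFun (P.simpleSmul s f x) x = |s x| * P.toFun (f x) x :=
  ae_of_forall_simpleFunc (s.pair (f : SimpleFunc X V))
    (Q := fun q x => P.toFun (q.1 • q.2) x = |q.1| * P.toFun q.2 x) fun q => P.smul_eq q.1 q.2

/-- The constant simple functions. -/
def constStep : V →ₗ[ℝ] P.Step where
  toFun c := SimpleFunc.const X c
  map_add' _ _ := rfl
  map_smul' _ _ := rfl

/-- Simple functions as elements of the seminormed space. -/
def stepOf (f : SimpleFunc X V) : P.Step := f

/-- The pointwise reverse triangle inequality. It makes `stepNorm` 1-Lipschitz, which allows its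
extension to the completion. -/
theorem norm_stepNorm_sub_le (f g : P.Step) : ‖P.stepNorm f - P.stepNorm g‖ ≤ ‖f - g‖ := by
  refine Lp.norm_le_norm_of_ae_le (g := P.stepNorm (f - g)) ?_
  have h1 := P.ae_step_add_le (f - g) g
  have h2 := P.ae_step_add_le ((-1 : ℝ) • (f - g)) f
  have h3 := P.ae_step_smul_eq (-1) (f - g)
  have e : (-1 : ℝ) • (f - g) + f = g := by module
  rw [sub_add_cancel] at h1
  rw [e] at h2
  filter_upwards [P.coeFn_stepNorm (f - g), P.coeFn_stepNorm f, P.coeFn_stepNorm g,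
    Lp.coeFn_sub (P.stepNorm f) (P.stepNorm g), h1, h2, h3] with x k1 k2 k3 k4 k5 k6 k7
  rw [k4, Pi.sub_apply, k1, k2, k3, Real.norm_of_nonneg (P.nonneg _ _), Real.norm_eq_abs, abs_le]
  rw [k7, abs_neg, abs_one, one_mul] at k6
  constructor <;> linarith

theorem norm_simpleSmul_le {s : SimpleFunc X ℝ} {C : ℝ}
    (hs : ∀ᵐ x ∂m, |s x| ≤ C) (f : P.Step) : ‖P.simpleSmul s f‖ ≤ C * ‖f‖ := by
  refine Lp.norm_le_mul_norm_of_ae_le_mul ?_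
  filter_upwards [P.coeFn_stepNorm (P.simpleSmul s f), P.coeFn_stepNorm f,
    P.ae_toFun_simpleSmul s f, hs] with x h1 h2 h3 h4
  rw [h1, h2, h3, Real.norm_of_nonneg (mul_nonneg (abs_nonneg _) (P.nonneg _ _)),
    Real.norm_of_nonneg (P.nonneg _ _)]
  exact mul_le_mul_of_nonneg_right h4 (P.nonneg _ _)

variable [Fact (1 ≤ p)]

/-- Only a seminorm: steps at distance zero become equal in the completion. -/
theorem step_core : SeminormedSpace.Core ℝ P.Step where
  norm_nonneg f := norm_nonneg (P.stepNorm f)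
  norm_smul c f := by
    have h : P.stepNorm (c • f) = |c| • P.stepNorm f := by
      refine Lp.ext ?_
      filter_upwards [P.coeFn_stepNorm (c • f), P.coeFn_stepNorm f,
        Lp.coeFn_smul |c| (P.stepNorm f), P.ae_step_smul_eq c f] with x h1 h2 h3 h4
      rw [h1, h3, Pi.smul_apply, h2, h4, smul_eq_mul]
    rw [norm_step_def, h, norm_smul, norm_step_def, Real.norm_eq_abs, abs_abs,
      Real.norm_eq_abs]
  norm_triangle f g := by
    refine (Lp.norm_le_norm_of_ae_le ?_).trans (norm_add_le (P.stepNorm f) (P.stepNorm g))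
    filter_upwards [P.coeFn_stepNorm (f + g), P.coeFn_stepNorm f, P.coeFn_stepNorm g,
      Lp.coeFn_add (P.stepNorm f) (P.stepNorm g), P.ae_step_add_le f g] with x h1 h2 h3 h4 h5
    rw [h1, h4, Pi.add_apply, h2, h3, Real.norm_of_nonneg (P.nonneg _ _)]
    exact h5.trans (le_abs_self _)

instance : SeminormedAddCommGroup P.Step := SeminormedAddCommGroup.ofCore P.step_core

instance : NormedSpace ℝ P.Step where
  norm_smul_le c f := (P.step_core.norm_smul c f).le

/-- The action of a real simple function as a bounded operator. -/
def simpleSmulL (s : SimpleFunc X ℝ) : P.Step →L[ℝ] P.Step :=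
  LinearMap.mkContinuous
    { toFun := P.simpleSmul s
      map_add' := fun _ _ => P.step_ext fun _ => smul_add _ _ _
      map_smul' := fun _ _ => P.step_ext fun _ => smul_comm _ _ _ }
    (s.exists_forall_norm_le).choose
    (P.norm_simpleSmul_le (Eventually.of_forall (s.exists_forall_norm_le).choose_spec))

/-- The completion of the space of simple functions. -/
abbrev Space : Type (max u v) := UniformSpace.Completion P.Step

open UniformSpace in
theorem denseRange_coe : DenseRange ((↑) : P.Step → P.Space) := Completion.denseRange_coe

open UniformSpace in
/-- The action of the real simple functions on the completion. -/
def simpleAction : SimpleFunc X ℝ →+* (P.Space →L[ℝ] P.Space) where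
  toFun s := (P.simpleSmulL s).completion
  map_one' := by
    refine ContinuousLinearMap.ext fun ω => ?_
    refine Completion.induction_on ω (isClosed_eq (ContinuousLinearMap.continuous _)
      (ContinuousLinearMap.continuous _)) fun f => ?_
    rw [ContinuousLinearMap.completion_apply_coe]
    exact congrArg _ (P.step_ext fun x => one_smul _ _)
  map_zero' := by
    refine ContinuousLinearMap.ext fun ω => ?_
    refine Completion.induction_on ω (isClosed_eq (ContinuousLinearMap.continuous _)
      (ContinuousLinearMap.continuous _)) fun f => ?_
    rw [ContinuousLinearMap.completion_apply_coe]
    exact congrArg (fun g : P.Step => (g : P.Space)) (P.step_ext fun x => zero_smul _ _)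
  map_mul' s t := by
    refine ContinuousLinearMap.ext fun ω => ?_
    refine Completion.induction_on ω (isClosed_eq (ContinuousLinearMap.continuous _)
      (ContinuousLinearMap.continuous _)) fun f => ?_
    rw [mul_apply_eq_comp, ContinuousLinearMap.completion_apply_coe,
      ContinuousLinearMap.completion_apply_coe, ContinuousLinearMap.completion_apply_coe]
    exact congrArg _ (P.step_ext fun x => mul_smul _ _ _)
  map_add' s t := by
    refine ContinuousLinearMap.ext fun ω => ?_
    refine Completion.induction_on ω (isClosed_eq (ContinuousLinearMap.continuous _)
      (ContinuousLinearMap.continuous _)) fun f => ?_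
    rw [add_apply, ContinuousLinearMap.completion_apply_coe,
      ContinuousLinearMap.completion_apply_coe, ContinuousLinearMap.completion_apply_coe,
      ← Completion.coe_add]
    exact congrArg _ (P.step_ext fun x => add_smul _ _ _)

theorem simpleAction_coe (s : SimpleFunc X ℝ) (f : P.Step) :
    P.simpleAction s (f : P.Space) = (P.simpleSmul s f : P.Step) :=
  ContinuousLinearMap.completion_apply_coe _ _

theorem norm_simpleAction_le (s : SimpleFunc X ℝ) (C : ℝ) (hC : 0 ≤ C)
    (hs : ∀ᵐ x ∂m, |s x| ≤ C) : ‖P.simpleAction s‖ ≤ C := by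
  refine ContinuousLinearMap.opNorm_le_bound _ hC fun ω => ?_
  refine UniformSpace.Completion.induction_on ω (isClosed_le
    (ContinuousLinearMap.continuous _).norm (continuous_const.mul continuous_norm)) fun f => ?_
  rw [simpleAction_coe, UniformSpace.Completion.norm_coe, UniformSpace.Completion.norm_coe]
  exact P.norm_simpleSmul_le hs f

/-- The action of the bounded functions on the completion. -/
def action : LInfty m →+* (P.Space →L[ℝ] P.Space) :=
  (exists_LInfty_ringHom P.simpleAction P.norm_simpleAction_le).choose

theorem norm_action_sub_le (f : LInfty m) (s : SimpleFunc X ℝ) (C : ℝ) (hC : 0 ≤ C)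
    (h : ∀ᵐ x ∂m, |(f : X →ₘ[m] ℝ) x - s x| ≤ C) : ‖P.action f - P.simpleAction s‖ ≤ C :=
  (exists_LInfty_ringHom P.simpleAction P.norm_simpleAction_le).choose_spec f s C hC h

theorem action_simpleClass (s : SimpleFunc X ℝ) :
    P.action (simpleClass m s) = P.simpleAction s := by
  rw [← sub_eq_zero, ← norm_le_zero_iff]
  refine P.norm_action_sub_le _ s 0 le_rfl ?_
  filter_upwards [coeFn_simpleClass (m := m) s] with x hx
  simp [hx]

theorem uniformContinuous_stepNorm : UniformContinuous P.stepNorm :=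
  (LipschitzWith.of_dist_le_mul (K := 1) fun f g => by
    rw [dist_eq_norm, dist_eq_norm]
    simpa using P.norm_stepNorm_sub_le f g).uniformContinuous

/-- The pointwise norm on the completion. -/
def ptNorm : P.Space → Lp ℝ p m := UniformSpace.Completion.extension P.stepNorm

theorem continuous_ptNorm : Continuous P.ptNorm := UniformSpace.Completion.continuous_extension

theorem ptNorm_coe (f : P.Step) : P.ptNorm f = P.stepNorm f :=
  UniformSpace.Completion.extension_coe P.uniformContinuous_stepNorm f

theorem ptNorm_nonneg (ω : P.Space) : 0 ≤ P.ptNorm ω :=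
  UniformSpace.Completion.induction_on ω (isClosed_le continuous_const P.continuous_ptNorm)
    fun f => (P.ptNorm_coe f).symm ▸ P.stepNorm_nonneg f

theorem norm_ptNorm (ω : P.Space) : ‖P.ptNorm ω‖ = ‖ω‖ :=
  UniformSpace.Completion.induction_on ω (isClosed_eq P.continuous_ptNorm.norm continuous_norm)
    fun f => by rw [ptNorm_coe, UniformSpace.Completion.norm_coe, norm_step_def]

/-- The identity holds for a simple function acting on a step. Approximating `f` uniformly and `ω`
in norm, both sides converge a.e. along a subsequence. -/
theorem ptNorm_action (f : LInfty m) (ω : P.Space) :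
    ∀ᵐ x ∂m, P.ptNorm (P.action f ω) x = |(f : X →ₘ[m] ℝ) x| * P.ptNorm ω x := by
  choose s hs using fun n : ℕ =>
    exists_simpleFunc_ae_abs_sub_le f (Nat.one_div_pos_of_nat (α := ℝ) (n := n))
  obtain ⟨g, hg, hgω⟩ := mem_closure_iff_seq_limit.1 (P.denseRange_coe ω)
  choose h hh using hg
  obtain rfl : (fun n => (h n : P.Space)) = g := funext hh
  have hT : Tendsto (fun n => P.simpleAction (s n)) atTop (𝓝 (P.action f)) := by
    rw [tendsto_iff_norm_sub_tendsto_zero]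
    refine squeeze_zero (fun _ => norm_nonneg _) (fun n => ?_)
      (tendsto_one_div_add_atTop_nhds_zero_nat (𝕜 := ℝ))
    rw [norm_sub_rev]
    exact P.norm_action_sub_le f (s n) _ (by positivity) (hs n)
  have h1 : Tendsto (fun n => P.ptNorm (P.simpleAction (s n) (h n))) atTop
      (𝓝 (P.ptNorm (P.action f ω))) :=
    (P.continuous_ptNorm.tendsto _).comp
      ((isBoundedBilinearMap_apply.continuous.tendsto (P.action f, ω)).comp (hT.prodMk_nhds hgω))
  have h2 : Tendsto (fun n => P.ptNorm (h n)) atTop (𝓝 (P.ptNorm ω)) :=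
    (P.continuous_ptNorm.tendsto _).comp hgω
  -- The second subsequence is extracted from the first, so that both convergences hold a.e. along
  -- `φ ∘ ψ`.
  obtain ⟨φ, hφ, h1'⟩ := (tendstoInMeasure_of_tendsto_Lp h1).exists_seq_tendsto_ae
  obtain ⟨ψ, hψ, h2'⟩ := (tendstoInMeasure_of_tendsto_Lp
    (h2.comp hφ.tendsto_atTop)).exists_seq_tendsto_ae
  filter_upwards [h1', h2', ae_all_iff.2 hs,
    ae_all_iff.2 fun n => P.ae_toFun_simpleSmul (s n) (h n),
    ae_all_iff.2 fun n => P.coeFn_stepNorm (P.simpleSmul (s n) (h n)),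
    ae_all_iff.2 fun n => P.coeFn_stepNorm (h n)] with x k1 k2 k3 k4 k5 k6
  have hs' : Tendsto (fun n => s n x) atTop (𝓝 ((f : X →ₘ[m] ℝ) x)) := by
    rw [tendsto_iff_norm_sub_tendsto_zero]
    refine squeeze_zero (fun _ => norm_nonneg _) (fun n => ?_)
      (tendsto_one_div_add_atTop_nhds_zero_nat (𝕜 := ℝ))
    rw [norm_sub_rev]
    exact k3 n
  have hsub := (hφ.comp hψ).tendsto_atTop
  have l1 := k1.comp hψ.tendsto_atTop
  have l2 := ((hs'.comp hsub).abs).mul k2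
  refine tendsto_nhds_unique l1 (l2.congr fun n => ?_)
  simp only [Function.comp_apply, simpleAction_coe, ptNorm_coe, k4, k5, k6]

/-- The normed module generated by a pointwise seminorm. -/
def toModule : LpNormedModule.{u, max u v} p m where
  carrier := P.Space
  module := Module.compHom P.Space P.action
  ptNorm ω := ofRealClass (P.ptNorm ω : X →ₘ[m] ℝ)
  ptNorm_smul f ω := by
    filter_upwards [coeFn_ofRealClass (P.ptNorm (P.action f ω) : X →ₘ[m] ℝ),
      coeFn_ofRealClass (P.ptNorm ω : X →ₘ[m] ℝ), P.ptNorm_action f ω] with x h1 h2 h3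
    refine h1.trans ?_
    rw [h2, h3, ENNReal.ofReal_mul (abs_nonneg _), ← Real.norm_eq_abs, ofReal_norm]
  enorm_eq ω := by
    rw [eLpNorm_ofRealClass ((Lp.coeFn_nonneg _).2 (P.ptNorm_nonneg ω)), ← Lp.enorm_def,
      ← ofReal_norm, ← ofReal_norm, norm_ptNorm]

/-- The constant functions, as elements of the module generated by a pointwise seminorm. -/
def d : V →ₗ[ℝ] P.toModule :=
  (UniformSpace.Completion.toComplₗᵢ (𝕜 := ℝ) (E := P.Step)).toLinearMap ∘ₗ P.constStep

theorem ptNorm_d (c : V) :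
    ∀ᵐ x ∂m, P.toModule.ptNorm (P.d c) x = ENNReal.ofReal (P.toFun c x) := by
  filter_upwards [coeFn_ofRealClass (P.ptNorm (P.constStep c) : X →ₘ[m] ℝ),
    P.coeFn_stepNorm (P.constStep c)] with x h1 h2
  refine h1.trans ?_
  rw [ptNorm_coe, h2]
  rfl

/-- Simple functions as elements of the module generated by a pointwise seminorm. -/
def ofStep (f : P.Step) : P.toModule := (f : P.Space)

theorem chi_smul_ofStep {B : Set X} (hB : MeasurableSet B) (g : P.Step) :
    LInfty.chi m hB • P.ofStep g = P.ofStep (P.simpleSmul (simpleChi hB) g) := by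
  refine Eq.trans ?_ (P.simpleAction_coe _ _)
  rw [← action_simpleClass, simpleClass_simpleChi]
  rfl

/-- Checked on each fibre `f = c`, where both sides are the step equal to `c` there and to `0`
elsewhere. Density of step forms thereby becomes density of a space in its completion. -/
theorem stepForm_d (f : SimpleFunc X V) :
    LpNormedModule.stepForm P.d f = P.ofStep (P.stepOf f) := by
  refine LpNormedModule.ext_of_chi_fiber_smul (M := P.toModule) f fun c => ?_
  refine (LpNormedModule.chi_smul_stepForm_of_eqOn P.d f (f.measurableSet_fiber c) (c := c)
    fun x hx => hx).trans ?_
  refine (P.chi_smul_ofStep _ (P.constStep c)).trans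
    (Eq.trans ?_ (P.chi_smul_ofStep _ _).symm)
  congr 1
  refine P.step_ext fun x => ?_
  rw [simpleSmul_apply, simpleSmul_apply, simpleChi_apply]
  by_cases hx : x ∈ f ⁻¹' {c}
  · have : P.stepOf f x = c := hx
    rw [this]
    rfl
  · rw [indicator_of_notMem hx, zero_smul, zero_smul]

theorem denseRange_stepForm_d : DenseRange (LpNormedModule.stepForm P.d) :=
  P.denseRange_coe.mono (by
    rintro _ ⟨f, rfl⟩
    exact ⟨f, P.stepForm_d f⟩)

theorem exists_module : ∃ (M : LpNormedModule.{u, max u v} p m) (d : V →ₗ[ℝ] M),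
    (∀ c, ∀ᵐ x ∂m, M.ptNorm (d c) x = ENNReal.ofReal (P.toFun c x)) ∧
      DenseRange (LpNormedModule.stepForm d) :=
  ⟨P.toModule, P.d, P.ptNorm_d, P.denseRange_stepForm_d⟩

end PointwiseSeminorm

/-! ### Minimal pseudo-gradients as a pointwise seminorm -/

namespace DStructure

variable {X : Type u} [MetricSpace X] [MeasurableSpace X] {p : ℝ≥0∞} {m : Measure X}
  {D : DStructure p m}

/-- The minimal pseudo-gradients of a pointwise local `D`-structure form a pointwise seminorm on
the Sobolev class. -/
theorem PointwiseLocal.exists_seminorm (hD : D.PointwiseLocal) (hp : 1 < p) :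
    ∃ P : PointwiseSeminorm D.sobolevClass p m, ∀ (u : D.sobolevClass) (g : X →ₘ[m] ℝ≥0∞),
      (∀ᵐ x ∂m, g x = ENNReal.ofReal (P.toFun u x)) → D.IsMinimalPG (u : LpLoc p m) g := by
  choose G hG using fun u : D.sobolevClass => exists_isMinimalPG hp u.2
  have hL : ∀ u, MemLp (G u) p m := fun u => (hG u).memLp u.2
  have hfin : ∀ u, ∀ᵐ x ∂m, G u x ≠ ∞ := fun u => ae_ne_top_of_memLp D.ne_zero D.lt_top.ne (hL u)
  have hlin : ∀ (a b : ℝ) (u v : D.sobolevClass),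
      ∀ᵐ x ∂m, (G (a • u + b • v) x).toReal ≤ |a| * (G u x).toReal + |b| * (G v x).toReal := by
    intro a b u v
    filter_upwards [hD.ae_le_of_isMinimalPG u.2 v.2 a b (hG u) (hG v) (hG (a • u + b • v)),
      hfin u, hfin v] with x h1 h2 h3
    have h4 := ENNReal.toReal_mono (by finiteness) h1
    rwa [ENNReal.toReal_add (by finiteness) (by finiteness), ENNReal.toReal_mul,
      ENNReal.toReal_mul, toReal_enorm, toReal_enorm] at h4
  refine ⟨
  { toFun := fun u x => (G u x).toReal
    measurable := fun u => (G u).stronglyMeasurable.measurable.ennreal_toReal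
    nonneg := fun _ _ => ENNReal.toReal_nonneg
    memLp := fun u => memLp_toReal D.ne_zero D.lt_top.ne (hL u)
    add_le := fun u v => by simpa using hlin 1 1 u v
    smul_eq := fun c u => by
      have h1 : ∀ (c : ℝ) (u : D.sobolevClass), ∀ᵐ x ∂m,
          (G (c • u) x).toReal ≤ |c| * (G u x).toReal := fun c u => by
        simpa using hlin c 0 u u
      by_cases hc : c = 0
      · filter_upwards [h1 c u] with x hx
        simp only [hc, abs_zero, zero_mul] at hx ⊢
        exact le_antisymm hx ENNReal.toReal_nonneg
      -- The reverse inequality is the same bound for the scalar `c⁻¹`, since `u = c⁻¹ • (c • u)`.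
      · have h2 := h1 c⁻¹ (c • u)
        rw [inv_smul_smul₀ hc] at h2
        filter_upwards [h1 c u, h2] with x k1 k2
        refine le_antisymm k1 ?_
        rwa [abs_inv, inv_mul_eq_div, le_div_iff₀ (abs_pos.2 hc), mul_comm] at k2 }, fun u g hg => ?_⟩
  have : g = G u := by
    refine AEEqFun.ext ?_
    filter_upwards [hg, hfin u] with x h1 h2
    rw [h1]
    exact ENNReal.ofReal_toReal h2
  exact this ▸ hG u

end DStructure

end

/-! ### Existence and uniqueness of the cotangent module -/

theorem theorem3p2 {X : Type u} [MetricSpace X] [CompleteSpace X]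
    [TopologicalSpace.SeparableSpace X] [MeasurableSpace X] [BorelSpace X]
    (m : Measure X) (hm : m ≠ 0) (hball : ∀ (x : X) (r : ℝ), m (Metric.ball x r) < ∞)
    (p : ℝ≥0∞) (hp₁ : 1 < p) (hp : p < ∞)
    (D : DStructure p m) (hD : D.PointwiseLocal) :
    (∀ u ∈ D.sobolevClass, ∃! g : X →ₘ[m] ℝ≥0∞, D.IsMinimalPG u g) ∧
    ∃ (M : LpNormedModule.{u, u} p m) (d : D.sobolevClass →ₗ[ℝ] M),
      D.IsCotangentModule M d ∧
      ∀ (N : LpNormedModule.{u, v} p m) (d' : D.sobolevClass →ₗ[ℝ] N),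
        D.IsCotangentModule N d' →
        ∃! Φ : M ≃ₗ[LInfty m] N,
          (∀ ω : M, N.ptNorm (Φ ω) = M.ptNorm ω) ∧
          ∀ u : D.sobolevClass, Φ (d u) = d' u := by
  have : Fact (1 ≤ p) := ⟨hp₁.le⟩
  obtain ⟨P, hP⟩ := hD.exists_seminorm hp₁
  obtain ⟨M, d, hMd, hdense⟩ := P.exists_module
  have hd : ∀ u : D.sobolevClass, D.IsMinimalPG u (M.ptNorm (d u)) := fun u => hP u _ (hMd u)
  refine ⟨fun u hu => hD.existsUnique_isMinimalPG hp₁ hu, M, d, ⟨hd, ?_⟩, fun N d' hN => ?_⟩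
  · rw [DStructure.simpleForms_eq_range_stepForm, LinearMap.coe_range]
    exact hdense
  · have h : DenseRange (LpNormedModule.stepForm (V := D.sobolevClass) d') := by
      have h := hN.dense
      rwa [DStructure.simpleForms_eq_range_stepForm, LinearMap.coe_range] at h
    -- The pointwise norms of `d u` and `d' u` are both minimal pseudo-gradients of `u`, hence
    -- equal.
    exact LpNormedModule.existsUnique_equiv (V := D.sobolevClass) (M := M) (N := N)
      D.ne_zero hp.ne _ _ hdense h fun u =>
        (hD.existsUnique_isMinimalPG hp₁ u.2).unique (hN.ptNorm_d u) (hd u)
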